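/- Let $0<\lambda<\mu<1$, write $\bar x=1-x$, and put $$\rho=\frac{\lambda\bar\mu}{\bar\lambda\mu},\qquad \pi_Q(0)=\frac{\bar\lambda\mu-\lambda\bar\mu}{\mu},\qquad \pi_Q(q)=\frac{\bar\lambda\mu-\lambda\bar\mu}{\bar\mu\mu}\,\rho^{q}\quad(q\ge 1).$$ Consider the discrete-time single-server queue in equilibrium: the initial length $Q_0$ has distribution $\pi_Q$ on $\mathbb{Z}_+$; the arrivals $\tilde X_1,\tilde X_2,\dots$ are i.i.d. Bernoulli$(\lambda)$ and independent of $Q_0$; $Q_{i+1}=Q_i+\tilde X_{i+1}-\tilde Y_i$; and, given $Q_0$ and the arrivals, the departure indicators $\tilde Y_0,\dots,\tilde Y_n\in\{0,1\}$ have the joint probability mass function $\prod_{i=0}^{n}P(\tilde y_i\mid q_i)$ for every $n$, where $P(1\mid 0)=0$, $P(0\mid 0)=1$, and $P(1\mid q)=\mu$, $P(0\mid q)=\bar\mu$ for $q>0$. Let $\Psi_i=(\tilde Y_i,Q_i)$, let $P(\tilde y)=\sum_{q\ge 0}P(\tilde y\mid q)\,\pi_Q(q)$ be the equilibrium output distribution,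 and let $$f(\tilde y,q)=\log\frac{P(\tilde y\mid q)}{P(\tilde y)},$$ so that $\sum_{i=0}^{n-1}f(\Psi_i)$ is the information density. Let $H(p)=-p\log p-\bar p\log\bar p$, let $C=H(\lambda)-\frac{\lambda}{\mu}H(\mu)$, and define $$c_{M0}=\frac{\bar\lambda}{\bar\mu}\Bigl(\mu\log\frac{\mu}{\lambda}+\bar\mu\log\frac{\bar\mu}{\bar\lambda}-C\Bigr),\qquad c_{\tilde M}=\frac{c_{M0}}{\mu}+\Bigl(C-\log\frac{\mu}{\lambda}\Bigr)\frac{\pi_Q(0)}{\bar\mu}.$$ Then the limit $$\sigma^2=\lim_{n\to\infty}\frac1n\operatorname{Var}\Bigl(\sum_{i=0}^{n-1}f(\Psi_i)\Bigr)$$ exists, the series $\sum_{i\ge 0}\operatorname{Cov}(f(\Psi_0),f(\Psi_i))$ converges absolutely, and $$\sigma^2=-\operatorname{Var}(f(\Psi_0))+2\sum_{i=0}^\infty\operatorname{Cov}(f(\Psi_0),f(\Psi_i)),$$ where $$\operatorname{Var}(f(\Psi_0))=\pi_Q(0)\log^2\frac1{\bar\lambda}+\mu\,(1-\pi_Q(0))\log^2\frac\mu\lambda+\bar\mu\,(1-\pi_Q(0))\log^2\frac{\bar\mu}{\bar\lambda}-C^2$$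 and $$\sum_{i=0}^\infty\operatorname{Cov}(f(\Psi_0),f(\Psi_i))=\log\frac1{\bar\lambda}\Bigl(-c_{\tilde M}\frac{\rho}{1-\rho}-c_{M0}\,\rho\Bigr)+\log\frac{\mu}{\lambda}\,c_{M0}\frac{\rho}{1-\rho}+\log\frac{\bar\mu}{\bar\lambda}\,\frac{\rho}{1-\rho}\bigl(c_{\tilde M}-\rho\,c_{M0}\bigr).$$ In particular $\sigma^2$ is an explicit function of $\lambda$ and $\mu$. -/

import Mathlib

open MeasureTheory ProbabilityTheory Filter Topology

noncomputable section

/-- Probability that a Bernoulli(`p`) bit equals `b` (`true` is the value `1`). -/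
def bernoulliProb (p : ℝ) : Bool → ℝ
  | true => p
  | false => 1 - p

/-- `P(ỹ | q)`: the probability that the server produces the output bit `y` (`true` is a departure)
when the queue has length `q`. -/
def serviceProb (mu : ℝ) : Bool → ℕ → ℝ
  | false, 0 => 1
  | true, 0 => 0
  | false, _ + 1 => 1 - mu
  | true, _ + 1 => mu

/-- `ρ = λ (1 - μ) / ((1 - λ) μ)`. -/
def rho (lam mu : ℝ) : ℝ := lam * (1 - mu) / ((1 - lam) * mu)

/-- The invariant distribution `π_Q` of the queue length. -/
def piQ (lam mu : ℝ) : ℕ → ℝ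
  | 0 => ((1 - lam) * mu - lam * (1 - mu)) / mu
  | q + 1 => ((1 - lam) * mu - lam * (1 - mu)) / ((1 - mu) * mu) * rho lam mu ^ (q + 1)

/-- The queue length `Q_i` as a function of the initial length `q₀`, the arrivals `a 1, a 2, …` and
the departures `d 0, d 1, …`: `Q_{i+1} = Q_i + a_{i+1} - d_i`.  (The subtraction of natural numbers
truncates only if `Q_i = 0` and `d_i = 1`, which has probability zero.) -/
def queueLength (q₀ : ℕ) (a d : ℕ → Bool) : ℕ → ℕ
  | 0 => q₀
  | i + 1 => queueLength q₀ a d i + (a (i + 1)).toNat - (d i).toNat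

/-- The queue in equilibrium, used as a channel: `Q₀` is the initial queue length, `A i` (for
`i ≥ 1`) indicates an arrival at time `i`, and `D i` (for `i ≥ 0`) indicates a departure at time
`i`.  The input consists of `Q₀ ∼ π_Q` and independent Bernoulli(`lam`) arrivals; given the input,
the output `D 0, …, D n` has the probability mass function `∏ i, P(D i | Q_i)`. -/
structure IsTimingChannel {Ω : Type*} [MeasurableSpace Ω] (P : Measure Ω) (lam mu : ℝ)
    (Q₀ : Ω → ℕ) (A D : ℕ → Ω → Bool) : Prop where
  measurable_init : Measurable Q₀
  measurable_arrival : ∀ i, Measurable (A i)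
  measurable_departure : ∀ i, Measurable (D i)
  law : ∀ (n q : ℕ) (a d : ℕ → Bool),
    P.real {ω | Q₀ ω = q ∧ (∀ i ∈ Finset.Icc 1 n, A i ω = a i) ∧
        ∀ i ∈ Finset.range (n + 1), D i ω = d i} =
      (piQ lam mu q * ∏ i ∈ Finset.Icc 1 n, bernoulliProb lam (a i)) *
        ∏ i ∈ Finset.range (n + 1), serviceProb mu (d i) (queueLength q a d i)

/-- The composed state `Ψ_i = (Ỹ_i, Q_i)` at time `i`. -/
def composedState {Ω : Type*} (Q₀ : Ω → ℕ) (A D : ℕ → Ω → Bool) (i : ℕ) (ω : Ω) : Bool × ℕ :=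
  (D i ω, queueLength (Q₀ ω) (fun j => A j ω) (fun j => D j ω) i)

/-- `P(ỹ)`: the output distribution in equilibrium, `∑_q P(ỹ | q) π_Q(q)`. -/
def outputProb (lam mu : ℝ) (y : Bool) : ℝ := ∑' q : ℕ, serviceProb mu y q * piQ lam mu q

/-- The information density per symbol, `f(ỹ, q) = log (P(ỹ | q) / P(ỹ))`. -/
def infoDensity (lam mu : ℝ) (ψ : Bool × ℕ) : ℝ :=
  Real.log (serviceProb mu ψ.1 ψ.2 / outputProb lam mu ψ.1)

/-- The capacity `C = H(λ) - (λ / μ) H(μ)`, with `H` the binary entropy function. -/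
def capacityC (lam mu : ℝ) : ℝ := Real.binEntropy lam - lam / mu * Real.binEntropy mu

/-- The explicit expression for `Var f(Ψ_0)`. -/
def varExpr (lam mu : ℝ) : ℝ :=
  Real.log (1 / (1 - lam)) ^ 2 * piQ lam mu 0
    + Real.log (mu / lam) ^ 2 * mu * (1 - piQ lam mu 0)
    + Real.log ((1 - mu) / (1 - lam)) ^ 2 * (1 - mu) * (1 - piQ lam mu 0)
    - capacityC lam mu ^ 2

/-- The constant `c_{M0}`. -/
def cM0 (lam mu : ℝ) : ℝ :=
  (1 - lam) / (1 - mu) *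
    (mu * Real.log (mu / lam) + (1 - mu) * Real.log ((1 - mu) / (1 - lam)) - capacityC lam mu)

/-- The constant `c_{M̃}`. -/
def cMtilde (lam mu : ℝ) : ℝ :=
  cM0 lam mu / mu + (capacityC lam mu - Real.log (mu / lam)) * (piQ lam mu 0 / (1 - mu))

/-- The explicit expression for `∑_{i ≥ 0} Cov(f(Ψ_0), f(Ψ_i))`. -/
def covSumExpr (lam mu : ℝ) : ℝ :=
  Real.log (1 / (1 - lam)) *
      (-cMtilde lam mu * (rho lam mu / (1 - rho lam mu)) - cM0 lam mu * rho lam mu)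
    + Real.log (mu / lam) * cM0 lam mu * (rho lam mu / (1 - rho lam mu))
    + Real.log ((1 - mu) / (1 - lam)) * (rho lam mu / (1 - rho lam mu)) *
      (cMtilde lam mu - rho lam mu * cM0 lam mu)

end

noncomputable section

/-! ### Equilibrium law, transition operator and Poisson equation -/

section Parameters

variable {lam mu : ℝ}

/-! Given `Q_i = q`, the mean of `f(Ψ_i)` takes one value at `q = 0` and another, `busyMean`, at
every `q ≥ 1`. The drift of the queue also takes two values, `λ` when empty and `λ - μ` when busy.
Since `C` is the equilibrium mean of `f`, the Poisson equation for `f` has a linear solution: with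
`T` the transition operator of the queue and `s` the `poissonSlope`, the conditional mean of `f` is
`C + s (q - T id q)` (`serviceMean_infoDensity_eq`).

By the Markov property the covariances telescope: `Cov(f(Ψ_0), f(Ψ_{n+1})) = s (u_n - u_{n+1})`,
where `u_n = Cov(f(Ψ_0), Q_{n+1})` (`covariance_infoDensity_succ`). If `u_n → 0`, the whole series
is `Var f(Ψ_0) + s u_0`, and `u_0` involves only one step of the queue. An algebraic identity
(`covSumExpr_eq`) turns this into the stated closed form.

The `u_n` decay geometrically: the increments `T^n id (q+1) - T^n id q` contract in a norm weighted
by `θ^q`, for any `1 < θ < 1/ρ` (`exists_abs_queueStep_iterate_sub_le`). This range makes the step a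
contraction and the weight `π_Q`-integrable (`exists_abs_lengthCov_le`).

Finally, the balance equations make the channel stationary (`shift_one`), so the variance of the
partial sums has increments converging to the two-sided covariance sum, and Cesàro averaging gives
the limit (`tendsto_variance_sum_div`). -/

lemma rho_pos (hlam : 0 < lam) (hlt : lam < mu) (hmu : mu < 1) : 0 < rho lam mu := by
  unfold rho
  have : 0 < 1 - mu := by linarith
  have : 0 < 1 - lam := by linarith
  have : 0 < mu := by linarith
  positivity

lemma one_sub_rho (hlam : 0 < lam) (hlt : lam < mu) (hmu : mu < 1) :
    1 - rho lam mu = (mu - lam) / ((1 - lam) * mu) := by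
  have : 1 - lam ≠ 0 := by linarith
  have : mu ≠ 0 := by linarith
  unfold rho
  field_simp
  ring

lemma rho_lt_one (hlam : 0 < lam) (hlt : lam < mu) (hmu : mu < 1) : rho lam mu < 1 := by
  have h : 0 < 1 - rho lam mu := by
    rw [one_sub_rho hlam hlt hmu]
    exact div_pos (by linarith) (mul_pos (by linarith) (by linarith))
  linarith

lemma piQ_zero (lam mu : ℝ) : piQ lam mu 0 = (mu - lam) / mu := by
  simp only [piQ]
  ring

lemma piQ_succ (lam mu : ℝ) (q : ℕ) :
    piQ lam mu (q + 1) = (mu - lam) / ((1 - mu) * mu) * rho lam mu * rho lam mu ^ q := by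
  simp only [piQ]
  ring

lemma piQ_nonneg (hlam : 0 < lam) (hlt : lam < mu) (hmu : mu < 1) (q : ℕ) : 0 ≤ piQ lam mu q := by
  have h1 : 0 < 1 - mu := by linarith
  have h2 : 0 < mu := by linarith
  have h3 : 0 < mu - lam := by linarith
  have h4 := rho_pos hlam hlt hmu
  cases q with
  | zero => rw [piQ_zero]; positivity
  | succ q => rw [piQ_succ]; positivity

lemma hasSum_piQ_succ (hlam : 0 < lam) (hlt : lam < mu) (hmu : mu < 1) :
    HasSum (fun q => piQ lam mu (q + 1)) (lam / mu) := by
  have h1 : 1 - mu ≠ 0 := by linarith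
  have h2 : mu ≠ 0 := by linarith
  have h3 : mu - lam ≠ 0 := by linarith
  have h4 : 1 - lam ≠ 0 := by linarith
  have h := (hasSum_geometric_of_lt_one (rho_pos hlam hlt hmu).le
    (rho_lt_one hlam hlt hmu)).mul_left ((mu - lam) / ((1 - mu) * mu) * rho lam mu)
  have e : lam / mu = (mu - lam) / ((1 - mu) * mu) * rho lam mu * (1 - rho lam mu)⁻¹ := by
    rw [one_sub_rho hlam hlt hmu]
    unfold rho
    field_simp
  simp only [piQ_succ]
  rwa [e]

/-- The busy states carry total mass `λ/μ`, so a function that only distinguishes empty from busy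
has a two-term expectation. -/
lemma hasSum_mul_piQ (hlam : 0 < lam) (hlt : lam < mu) (hmu : mu < 1) {φ : ℕ → ℝ} {c : ℝ}
    (hφ : ∀ q, φ (q + 1) = c) :
    HasSum (fun q => φ q * piQ lam mu q) (φ 0 * ((mu - lam) / mu) + c * (lam / mu)) := by
  have h : HasSum (fun q => φ (q + 1) * piQ lam mu (q + 1)) (c * (lam / mu)) := by
    simpa only [hφ] using (hasSum_piQ_succ hlam hlt hmu).mul_left c
  simpa only [piQ_zero] using h.zero_add (f := fun q => φ q * piQ lam mu q)

lemma hasSum_natCast_mul_piQ (hlam : 0 < lam) (hlt : lam < mu) (hmu : mu < 1) :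
    HasSum (fun q : ℕ => (q : ℝ) * piQ lam mu q) (lam * (1 - lam) / (mu - lam)) := by
  have h1 : 1 - mu ≠ 0 := by linarith
  have h2 : mu ≠ 0 := by linarith
  have h3 : mu - lam ≠ 0 := by linarith
  have h4 : 1 - lam ≠ 0 := by linarith
  have hr : ‖rho lam mu‖ < 1 := by
    rw [Real.norm_of_nonneg (rho_pos hlam hlt hmu).le]
    exact rho_lt_one hlam hlt hmu
  have h := (hasSum_coe_mul_geometric_of_norm_lt_one hr).mul_left ((mu - lam) / ((1 - mu) * mu))
  have e : lam * (1 - lam) / (mu - lam) =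
      (mu - lam) / ((1 - mu) * mu) * (rho lam mu / (1 - rho lam mu) ^ 2) := by
    rw [one_sub_rho hlam hlt hmu]
    unfold rho
    field_simp
  rw [e]
  refine h.congr_fun fun q => ?_
  cases q with
  | zero => simp
  | succ q => rw [piQ_succ, pow_succ]; ring

lemma outputProb_true (hlam : 0 < lam) (hlt : lam < mu) (hmu : mu < 1) :
    outputProb lam mu true = lam := by
  have h := hasSum_mul_piQ hlam hlt hmu (φ := serviceProb mu true) (c := mu) fun q => rfl
  have h2 : mu ≠ 0 := by linarith
  rw [outputProb, h.tsum_eq]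
  simp only [serviceProb]
  field_simp
  ring

lemma outputProb_false (hlam : 0 < lam) (hlt : lam < mu) (hmu : mu < 1) :
    outputProb lam mu false = 1 - lam := by
  have h := hasSum_mul_piQ hlam hlt hmu (φ := serviceProb mu false) (c := 1 - mu) fun q => rfl
  have h2 : mu ≠ 0 := by linarith
  rw [outputProb, h.tsum_eq]
  simp only [serviceProb]
  field_simp
  ring

lemma infoDensity_false_zero (hlam : 0 < lam) (hlt : lam < mu) (hmu : mu < 1) :
    infoDensity lam mu (false, 0) = Real.log (1 / (1 - lam)) := by
  simp [infoDensity, serviceProb, outputProb_false hlam hlt hmu]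

lemma infoDensity_true_succ (hlam : 0 < lam) (hlt : lam < mu) (hmu : mu < 1) (q : ℕ) :
    infoDensity lam mu (true, q + 1) = Real.log (mu / lam) := by
  simp [infoDensity, serviceProb, outputProb_true hlam hlt hmu]

lemma infoDensity_false_succ (hlam : 0 < lam) (hlt : lam < mu) (hmu : mu < 1) (q : ℕ) :
    infoDensity lam mu (false, q + 1) = Real.log ((1 - mu) / (1 - lam)) := by
  simp [infoDensity, serviceProb, outputProb_false hlam hlt hmu]

lemma exists_abs_infoDensity_le (hlam : 0 < lam) (hlt : lam < mu) (hmu : mu < 1) :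
    ∃ B, 0 ≤ B ∧ ∀ s, |infoDensity lam mu s| ≤ B := by
  refine ⟨|Real.log (1 / (1 - lam))| + |Real.log (mu / lam)| +
    |Real.log ((1 - mu) / (1 - lam))|, by positivity, ?_⟩
  have h1 := abs_nonneg (Real.log (1 / (1 - lam)))
  have h2 := abs_nonneg (Real.log (mu / lam))
  have h3 := abs_nonneg (Real.log ((1 - mu) / (1 - lam)))
  rintro ⟨_ | _, _ | q⟩
  · rw [infoDensity_false_zero hlam hlt hmu]; linarith
  · rw [infoDensity_false_succ hlam hlt hmu]; linarith
  · have : infoDensity lam mu (true, 0) = 0 := by simp [infoDensity, serviceProb]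
    rw [this, abs_zero]; linarith
  · rw [infoDensity_true_succ hlam hlt hmu]; linarith

/-- The mean information density in a busy slot. -/
def busyMean (lam mu : ℝ) : ℝ :=
  mu * Real.log (mu / lam) + (1 - mu) * Real.log ((1 - mu) / (1 - lam))

/-- This makes `C` the equilibrium mean of `f`, the solvability condition of the Poisson equation.
-/
lemma capacityC_eq (hlam : 0 < lam) (hlt : lam < mu) (hmu : mu < 1) :
    capacityC lam mu =
      Real.log (1 / (1 - lam)) * ((mu - lam) / mu) + busyMean lam mu * (lam / mu) := by
  have h1 : 1 - mu ≠ 0 := by linarith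
  have h2 : mu ≠ 0 := by linarith
  have h3 : lam ≠ 0 := by linarith
  have h4 : 1 - lam ≠ 0 := by linarith
  rw [capacityC, busyMean, Real.binEntropy_eq_negMulLog_add_negMulLog_one_sub,
    Real.binEntropy_eq_negMulLog_add_negMulLog_one_sub, Real.log_div h2 h3, Real.log_div h1 h4,
    Real.log_div one_ne_zero h4, Real.log_one]
  simp only [Real.negMulLog]
  field_simp
  ring

/-- The conditional mean of `φ (Ỹ, Q)` given `Q = q`. -/
def serviceMean (mu : ℝ) (φ : Bool × ℕ → ℝ) (q : ℕ) : ℝ :=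
  serviceProb mu false q * φ (false, q) + serviceProb mu true q * φ (true, q)

/-- The conditional mean of `h (Q_{i+1})` given `Ψ_i = s`. -/
def arrivalMean (lam : ℝ) (h : ℕ → ℝ) (s : Bool × ℕ) : ℝ :=
  (1 - lam) * h (s.2 - s.1.toNat) + lam * h (s.2 + 1 - s.1.toNat)

/-- The transition operator of the queue length. -/
def queueStep (lam mu : ℝ) (h : ℕ → ℝ) : ℕ → ℝ := serviceMean mu (arrivalMean lam h)

lemma queueStep_zero (lam mu : ℝ) (h : ℕ → ℝ) :
    queueStep lam mu h 0 = (1 - lam) * h 0 + lam * h 1 := by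
  simp [queueStep, serviceMean, arrivalMean, serviceProb]

lemma queueStep_succ (lam mu : ℝ) (h : ℕ → ℝ) (q : ℕ) :
    queueStep lam mu h (q + 1) =
      (1 - mu) * ((1 - lam) * h (q + 1) + lam * h (q + 2)) +
        mu * ((1 - lam) * h q + lam * h (q + 1)) := by
  simp [queueStep, serviceMean, arrivalMean, serviceProb]

lemma serviceMean_infoDensity_zero (hlam : 0 < lam) (hlt : lam < mu) (hmu : mu < 1) :
    serviceMean mu (infoDensity lam mu) 0 = Real.log (1 / (1 - lam)) := by
  simp only [serviceMean, serviceProb, infoDensity_false_zero hlam hlt hmu]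
  ring

lemma serviceMean_infoDensity_succ (hlam : 0 < lam) (hlt : lam < mu) (hmu : mu < 1) (q : ℕ) :
    serviceMean mu (infoDensity lam mu) (q + 1) = busyMean lam mu := by
  simp only [serviceMean, serviceProb, infoDensity_false_succ hlam hlt hmu,
    infoDensity_true_succ hlam hlt hmu, busyMean]
  ring

/-- The slope of the linear solution of the Poisson equation for the information density. -/
def poissonSlope (lam mu : ℝ) : ℝ := (busyMean lam mu - capacityC lam mu) / (mu - lam)

/-- The Poisson equation. `q - T id q` is `μ - λ` when busy, which fixes the slope; when empty it is
`-λ`, and the equation then reduces to `capacityC_eq`. -/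
lemma serviceMean_infoDensity_eq (hlam : 0 < lam) (hlt : lam < mu) (hmu : mu < 1) (q : ℕ) :
    serviceMean mu (infoDensity lam mu) q =
      capacityC lam mu + poissonSlope lam mu * (q - queueStep lam mu Nat.cast q) := by
  have h2 : mu ≠ 0 := by linarith
  have h3 : mu - lam ≠ 0 := by linarith
  cases q with
  | zero =>
    rw [serviceMean_infoDensity_zero hlam hlt hmu, queueStep_zero, poissonSlope,
      capacityC_eq hlam hlt hmu]
    push_cast
    field_simp
    ring
  | succ q =>
    rw [serviceMean_infoDensity_succ hlam hlt hmu, queueStep_succ, poissonSlope]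
    push_cast
    field_simp
    ring

/-- The successive expected queue lengths grow in the initial length at an exponentially small
rate, up to an exponential weight which `π_Q` integrates. -/
lemma exists_abs_queueStep_iterate_sub_le (hlam : 0 < lam) (hlt : lam < mu) (hmu : mu < 1) :
    ∃ θ γ : ℝ, 1 < θ ∧ θ * rho lam mu < 1 ∧ 0 ≤ γ ∧ γ < 1 ∧ ∀ n q : ℕ,
      |(queueStep lam mu)^[n] Nat.cast (q + 1) - (queueStep lam mu)^[n] Nat.cast q| ≤
        γ ^ n * θ ^ q := by
  have hr := rho_pos hlam hlt hmu
  have hr1 := rho_lt_one hlam hlt hmu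
  -- `θ < 1/ρ` serves both the contraction and the integrability of `θ^q`.
  obtain ⟨θ, h1θ, hθ⟩ := exists_between ((one_lt_inv₀ hr).2 hr1)
  have hθr : θ * rho lam mu < 1 := by rwa [← lt_inv_mul_iff₀' hr, mul_one]
  have hθ0 : 0 < θ := by linarith
  have hl' : 0 < 1 - lam := by linarith
  have hm' : 0 < 1 - mu := by linarith
  have hm : 0 < mu := by linarith
  have hpr : θ * (lam * (1 - mu)) < (1 - lam) * mu := by
    rwa [rho, ← mul_div_assoc, div_lt_one (by positivity)] at hθr
  -- The weighted row sums of the operator on increments: at the boundary `q = 0`, where the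
  -- downward term is missing, and in the interior.
  set γ := max (lam * (1 - mu) * θ + (1 - mu) * (1 - lam))
    (lam * (1 - mu) * θ + (lam * mu + (1 - mu) * (1 - lam)) + mu * (1 - lam) / θ) with hγ
  have hγ0 : 0 ≤ γ := le_max_of_le_left (by positivity)
  refine ⟨θ, γ, h1θ, hθr, hγ0, ?_, ?_⟩
  · refine max_lt (by nlinarith) ?_
    -- At `θ = 1` the interior row sum is exactly 1; the difference factors with roots `θ = 1` and
    -- `θ = 1/ρ`, hence is strict in between.
    have : lam * (1 - mu) * θ + mu * (1 - lam) / θ < lam * (1 - mu) + mu * (1 - lam) := by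
      rw [← sub_pos]
      have : lam * (1 - mu) + mu * (1 - lam) - (lam * (1 - mu) * θ + mu * (1 - lam) / θ) =
          (θ - 1) * ((1 - lam) * mu - θ * (lam * (1 - mu))) / θ := by
        field_simp
        ring
      rw [this]
      exact div_pos (mul_pos (by linarith) (by linarith)) hθ0
    nlinarith
  · intro n
    induction n with
    | zero =>
      intro q
      simpa using one_le_pow₀ h1θ.le
    | succ n ih =>
      intro q
      rw [Function.iterate_succ_apply']
      set h := (queueStep lam mu)^[n] Nat.cast with hh
      cases q with
      | zero =>
        have e : queueStep lam mu h (0 + 1) - queueStep lam mu h 0 =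
            lam * (1 - mu) * (h (1 + 1) - h 1) + (1 - mu) * (1 - lam) * (h (0 + 1) - h 0) := by
          rw [queueStep_succ, queueStep_zero]; ring
        rw [e]
        calc _ ≤ lam * (1 - mu) * |h (1 + 1) - h 1| + (1 - mu) * (1 - lam) * |h (0 + 1) - h 0| := by
              refine (abs_add_le _ _).trans_eq ?_
              rw [abs_mul (_ * _), abs_mul (_ * _), abs_of_nonneg (by positivity : 0 ≤ lam * (1 - mu)),
                abs_of_nonneg (by positivity : 0 ≤ (1 - mu) * (1 - lam))]
          _ ≤ lam * (1 - mu) * (γ ^ n * θ ^ 1) + (1 - mu) * (1 - lam) * (γ ^ n * θ ^ 0) := by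
              gcongr
              · exact ih 1
              · exact ih 0
          _ = γ ^ n * (lam * (1 - mu) * θ + (1 - mu) * (1 - lam)) := by ring
          _ ≤ γ ^ n * γ := by gcongr; exact le_max_left _ _
          _ = _ := by ring
      | succ q =>
        have e : queueStep lam mu h (q + 1 + 1) - queueStep lam mu h (q + 1) =
            lam * (1 - mu) * (h (q + 2 + 1) - h (q + 2)) +
              (lam * mu + (1 - mu) * (1 - lam)) * (h (q + 1 + 1) - h (q + 1)) +
              mu * (1 - lam) * (h (q + 1) - h q) := by
          rw [queueStep_succ, queueStep_succ]; ring
        rw [e]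
        calc _ ≤ lam * (1 - mu) * |h (q + 2 + 1) - h (q + 2)| +
              (lam * mu + (1 - mu) * (1 - lam)) * |h (q + 1 + 1) - h (q + 1)| +
              mu * (1 - lam) * |h (q + 1) - h q| := by
              refine (abs_add_three _ _ _).trans_eq ?_
              rw [abs_mul (_ * _), abs_mul (_ + _), abs_mul (_ * _),
                abs_of_nonneg (by positivity : 0 ≤ lam * (1 - mu)),
                abs_of_nonneg (by positivity : 0 ≤ lam * mu + (1 - mu) * (1 - lam)),
                abs_of_nonneg (by positivity : 0 ≤ mu * (1 - lam))]
          _ ≤ lam * (1 - mu) * (γ ^ n * θ ^ (q + 2)) +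
              (lam * mu + (1 - mu) * (1 - lam)) * (γ ^ n * θ ^ (q + 1)) +
              mu * (1 - lam) * (γ ^ n * θ ^ q) := by
              gcongr
              · exact ih _
              · exact ih _
              · exact ih _
          _ = γ ^ n * θ ^ (q + 1) * (lam * (1 - mu) * θ + (lam * mu + (1 - mu) * (1 - lam)) +
                mu * (1 - lam) / θ) := by
              field_simp
              ring
          _ ≤ γ ^ n * θ ^ (q + 1) * γ := by gcongr; exact le_max_right _ _
          _ = _ := by ring

lemma summable_pow_mul_piQ (hlam : 0 < lam) (hlt : lam < mu) (hmu : mu < 1) {θ : ℝ} (hθ : 0 ≤ θ)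
    (h : θ * rho lam mu < 1) : Summable fun q => θ ^ q * piQ lam mu q := by
  rw [← summable_nat_add_iff 1]
  have hs := (summable_geometric_of_lt_one (mul_nonneg hθ (rho_pos hlam hlt hmu).le) h).mul_left
    ((mu - lam) / ((1 - mu) * mu) * rho lam mu * θ)
  refine hs.congr fun q => ?_
  rw [piQ_succ, mul_pow]
  ring

/-- The variance is the term `i = 0`, and the bracket is `Cov(f(Ψ_0), Q_1)`, as
`lengthCov_infoDensity_one` shows. Once `C` is expanded, this is a rational identity with the three
logarithms as free variables. -/
lemma covSumExpr_eq (hlam : 0 < lam) (hlt : lam < mu) (hmu : mu < 1) :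
    covSumExpr lam mu = varExpr lam mu + poissonSlope lam mu *
      ((busyMean lam mu - capacityC lam mu) * (lam * (1 - lam) / (mu - lam)) -
        (Real.log (mu / lam) - capacityC lam mu) * lam) := by
  have h1 : 1 - mu ≠ 0 := by linarith
  have h2 : mu ≠ 0 := by linarith
  have h3 : mu - lam ≠ 0 := by linarith
  have h4 : 1 - lam ≠ 0 := by linarith
  have hC := capacityC_eq hlam hlt hmu
  rw [covSumExpr, varExpr, poissonSlope, cMtilde, cM0, one_sub_rho hlam hlt hmu, piQ_zero, hC]
  unfold busyMean rho
  generalize Real.log (1 / (1 - lam)) = a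
  generalize Real.log (mu / lam) = l
  generalize Real.log ((1 - mu) / (1 - lam)) = k
  field_simp
  ring

end Parameters

/-! ### Finite histories as points of a countable space -/

section History

lemma forall_mem_Icc_one_iff {n : ℕ} {p : ℕ → Prop} :
    (∀ i ∈ Finset.Icc 1 n, p i) ↔ ∀ i ∈ Finset.range n, p (i + 1) := by
  simp only [Finset.mem_Icc, Finset.mem_range]
  refine ⟨fun h i hi => h _ ⟨by omega, by omega⟩, fun h i hi => ?_⟩
  obtain ⟨j, rfl⟩ := Nat.exists_eq_add_of_le' hi.1
  exact h j (by omega)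

lemma prod_Icc_one_eq_prod_range (f : ℕ → ℝ) (n : ℕ) :
    ∏ i ∈ Finset.Icc 1 n, f i = ∏ i ∈ Finset.range n, f (i + 1) := by
  induction n with
  | zero => simp
  | succ n ih => rw [Finset.prod_Icc_succ_top (by omega), ih, Finset.prod_range_succ]

lemma queueLength_congr {q : ℕ} {a a' d d' : ℕ → Bool} {n : ℕ}
    (ha : ∀ i ∈ Finset.range n, a (i + 1) = a' (i + 1)) (hd : ∀ i ∈ Finset.range n, d i = d' i) :
    queueLength q a d n = queueLength q a' d' n := by
  induction n with
  | zero => rfl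
  | succ n ih =>
    rw [queueLength, queueLength, ha n (by simp), hd n (by simp),
      ih (fun i hi => ha i (by simp at hi ⊢; omega)) (fun i hi => hd i (by simp at hi ⊢; omega))]

lemma queueLength_succ_eq (q : ℕ) (a d : ℕ → Bool) (n : ℕ) :
    queueLength q a d (n + 1) = queueLength (queueLength q a d 1) (fun i => a (i + 1))
      (fun i => d (i + 1)) n := by
  induction n with
  | zero => rfl
  | succ n ih => rw [queueLength, ih]; rfl

lemma queueLength_le (q : ℕ) (a d : ℕ → Bool) (n : ℕ) : queueLength q a d n ≤ q + n := by
  induction n with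
  | zero => rfl
  | succ n ih =>
    have := Bool.toNat_le (a (n + 1))
    rw [queueLength]
    omega

/-- A finite sequence of bits, extended by zeros. -/
def extendBits {n : ℕ} (v : Fin n → Bool) (i : ℕ) : Bool := if h : i < n then v ⟨i, h⟩ else false

lemma extendBits_of_lt {n : ℕ} (v : Fin n → Bool) {i : ℕ} (h : i < n) :
    extendBits v i = v ⟨i, h⟩ := dif_pos h

variable {Ω : Type*} {Q₀ : Ω → ℕ} {A D : ℕ → Ω → Bool}

/-- The initial queue length, the arrivals and the departures up to time `n`. -/
def history (Q₀ : Ω → ℕ) (A D : ℕ → Ω → Bool) (n : ℕ) (ω : Ω) :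
    ℕ × (Fin n → Bool) × (Fin (n + 1) → Bool) :=
  (Q₀ ω, fun i => A (i + 1) ω, fun i => D i ω)

/-- The composed state at time `i`, as a function of a history. -/
def historyState {n : ℕ} (i : ℕ) (s : ℕ × (Fin n → Bool) × (Fin (n + 1) → Bool)) : Bool × ℕ :=
  (extendBits s.2.2 i, queueLength s.1 (fun j => extendBits s.2.1 (j - 1)) (extendBits s.2.2) i)

/-- `Q_i` reads only arrivals `1, …, i` and departures before `i`, so the padding by `false` is
never seen. Arrival `j` is stored at index `j - 1`. -/
lemma historyState_history {i n : ℕ} (h : i ≤ n) (ω : Ω) :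
    historyState i (history Q₀ A D n ω) = composedState Q₀ A D i ω := by
  refine Prod.ext (extendBits_of_lt _ (by omega)) (queueLength_congr (fun j hj => ?_) fun j hj => ?_)
  · rw [Finset.mem_range] at hj
    exact extendBits_of_lt _ (by omega)
  · rw [Finset.mem_range] at hj
    exact extendBits_of_lt _ (by omega)

lemma history_eq_iff {n : ℕ} {ω : Ω} {s : ℕ × (Fin n → Bool) × (Fin (n + 1) → Bool)} :
    history Q₀ A D n ω = s ↔ Q₀ ω = s.1 ∧
      (∀ i ∈ Finset.Icc 1 n, A i ω = extendBits s.2.1 (i - 1)) ∧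
        ∀ i ∈ Finset.range (n + 1), D i ω = extendBits s.2.2 i := by
  rw [forall_mem_Icc_one_iff]
  constructor
  · rintro rfl
    refine ⟨rfl, fun i hi => ?_, fun i hi => ?_⟩
    · rw [Finset.mem_range] at hi
      exact (extendBits_of_lt (fun j : Fin n => A (j + 1) ω) hi).symm
    · rw [Finset.mem_range] at hi
      exact (extendBits_of_lt (fun j : Fin (n + 1) => D j ω) hi).symm
  · rintro ⟨h1, h2, h3⟩
    refine Prod.ext h1 (Prod.ext (funext fun i => ?_) (funext fun i => ?_))
    · exact (h2 i (by simp)).trans (extendBits_of_lt _ i.2)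
    · exact (h3 i (Finset.mem_range.2 i.2)).trans (extendBits_of_lt _ i.2)

end History

/-! ### Law of the histories and stationarity -/

section Channel

variable {Ω : Type*} [MeasurableSpace Ω] {P : Measure Ω} {lam mu : ℝ} {Q₀ : Ω → ℕ}
  {A D : ℕ → Ω → Bool}

lemma IsTimingChannel.measurable_history (hch : IsTimingChannel P lam mu Q₀ A D) (n : ℕ) :
    Measurable (history Q₀ A D n) :=
  hch.measurable_init.prodMk
    ((measurable_pi_lambda _ fun _ => hch.measurable_arrival _).prodMk
      (measurable_pi_lambda _ fun _ => hch.measurable_departure _))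

lemma IsTimingChannel.measurable_composedState (hch : IsTimingChannel P lam mu Q₀ A D) (n : ℕ) :
    Measurable (composedState Q₀ A D n) := by
  have h : composedState Q₀ A D n = historyState n ∘ history Q₀ A D n :=
    funext fun ω => (historyState_history le_rfl ω).symm
  rw [h]
  exact (Measurable.of_discrete).comp (hch.measurable_history n)

lemma IsTimingChannel.measureReal_history (hch : IsTimingChannel P lam mu Q₀ A D) (n : ℕ)
    (s : ℕ × (Fin n → Bool) × (Fin (n + 1) → Bool)) :
    P.real (history Q₀ A D n ⁻¹' {s}) =
      (piQ lam mu s.1 * ∏ i ∈ Finset.Icc 1 n, bernoulliProb lam (extendBits s.2.1 (i - 1))) *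
        ∏ i ∈ Finset.range (n + 1), serviceProb mu (extendBits s.2.2 i)
          (queueLength s.1 (fun j => extendBits s.2.1 (j - 1)) (extendBits s.2.2) i) := by
  rw [← hch.law n s.1 (fun i => extendBits s.2.1 (i - 1)) (extendBits s.2.2)]
  congr 1
  ext ω
  exact history_eq_iff

/-- All the timing channels with given parameters have the same law. -/
lemma IsTimingChannel.map_history_eq [IsFiniteMeasure P] (hch : IsTimingChannel P lam mu Q₀ A D)
    {Ω' : Type*} [MeasurableSpace Ω'] {P' : Measure Ω'} [IsFiniteMeasure P'] {Q₀' : Ω' → ℕ}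
    {A' D' : ℕ → Ω' → Bool} (hch' : IsTimingChannel P' lam mu Q₀' A' D') (n : ℕ) :
    P.map (history Q₀ A D n) = P'.map (history Q₀' A' D' n) := by
  refine Measure.ext_of_singleton fun s => ?_
  rw [Measure.map_apply (hch.measurable_history n) (measurableSet_singleton s),
    Measure.map_apply (hch'.measurable_history n) (measurableSet_singleton s),
    ← ofReal_measureReal, ← ofReal_measureReal, hch.measureReal_history, hch'.measureReal_history]

/-- The next queue length, given the composed state and the next arrival. -/
def nextLength (x : Bool) (s : Bool × ℕ) : ℕ := s.2 + x.toNat - s.1.toNat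

/-- The product law at `n + 1` is the law at `n` times two new factors, because no queue length up
to time `n` reads the new bits. -/
lemma IsTimingChannel.measureReal_history_inter (hch : IsTimingChannel P lam mu Q₀ A D) (n : ℕ)
    (s : ℕ × (Fin n → Bool) × (Fin (n + 1) → Bool)) (x y : Bool) :
    P.real (history Q₀ A D n ⁻¹' {s} ∩ {ω | A (n + 1) ω = x ∧ D (n + 1) ω = y}) =
      bernoulliProb lam x * serviceProb mu y (nextLength x (historyState n s)) *
        P.real (history Q₀ A D n ⁻¹' {s}) := by
  set a : ℕ → Bool := fun i => extendBits s.2.1 (i - 1) with ha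
  set d : ℕ → Bool := extendBits s.2.2 with hd
  have hlaw := hch.law (n + 1) s.1 (Function.update a (n + 1) x) (Function.update d (n + 1) y)
  have hset : history Q₀ A D n ⁻¹' {s} ∩ {ω | A (n + 1) ω = x ∧ D (n + 1) ω = y} =
      {ω | Q₀ ω = s.1 ∧ (∀ i ∈ Finset.Icc 1 (n + 1), A i ω = Function.update a (n + 1) x i) ∧
        ∀ i ∈ Finset.range (n + 1 + 1), D i ω = Function.update d (n + 1) y i} := by
    ext ω
    have e1 : ∀ i ∈ Finset.range n, Function.update a (n + 1) x (i + 1) = a (i + 1) := by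
      intro i hi
      rw [Finset.mem_range] at hi
      exact Function.update_of_ne (by omega) _ _
    have e2 : ∀ i ∈ Finset.range (n + 1), Function.update d (n + 1) y i = d i := by
      intro i hi
      rw [Finset.mem_range] at hi
      exact Function.update_of_ne (by omega) _ _
    have f1 : (∀ i ∈ Finset.range (n + 1), A (i + 1) ω = Function.update a (n + 1) x (i + 1)) ↔
        A (n + 1) ω = x ∧ ∀ i ∈ Finset.range n, A (i + 1) ω = a (i + 1) := by
      rw [Finset.range_add_one, Finset.forall_mem_insert, Function.update_self,
        forall₂_congr fun i hi => by rw [e1 i hi]]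
    have f2 : (∀ i ∈ Finset.range (n + 1 + 1), D i ω = Function.update d (n + 1) y i) ↔
        D (n + 1) ω = y ∧ ∀ i ∈ Finset.range (n + 1), D i ω = d i := by
      rw [Finset.range_add_one, Finset.forall_mem_insert, Function.update_self,
        forall₂_congr fun i hi => by rw [e2 i hi]]
    simp only [Set.mem_inter_iff, Set.mem_preimage, Set.mem_singleton_iff, history_eq_iff,
      Set.mem_ofPred_eq, forall_mem_Icc_one_iff, ha, hd] at f1 f2 ⊢
    tauto
  -- Even `Q_{n+1}` does not depend on the departure at time `n + 1`.
  have hq : ∀ i ≤ n + 1, queueLength s.1 (Function.update a (n + 1) x)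
      (Function.update d (n + 1) y) i = queueLength s.1 (Function.update a (n + 1) x) d i := by
    intro i hi
    refine queueLength_congr (fun j hj => rfl) fun j hj => ?_
    rw [Finset.mem_range] at hj
    exact Function.update_of_ne (by omega) _ _
  have hq' : ∀ i ≤ n, queueLength s.1 (Function.update a (n + 1) x) d i =
      queueLength s.1 a d i := by
    intro i hi
    refine queueLength_congr (fun j hj => ?_) fun j hj => rfl
    rw [Finset.mem_range] at hj
    exact Function.update_of_ne (by omega) _ _
  rw [hset, hlaw, hch.measureReal_history, Finset.prod_Icc_succ_top (by omega),
    Finset.prod_range_succ _ (n + 1), Function.update_self, Function.update_self]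
  have p1 : ∏ i ∈ Finset.Icc 1 n, bernoulliProb lam (Function.update a (n + 1) x i) =
      ∏ i ∈ Finset.Icc 1 n, bernoulliProb lam (a i) := by
    refine Finset.prod_congr rfl fun i hi => ?_
    rw [Finset.mem_Icc] at hi
    rw [Function.update_of_ne (by omega)]
  have p2 : ∏ i ∈ Finset.range (n + 1), serviceProb mu (Function.update d (n + 1) y i)
      (queueLength s.1 (Function.update a (n + 1) x) (Function.update d (n + 1) y) i) =
      ∏ i ∈ Finset.range (n + 1), serviceProb mu (d i) (queueLength s.1 a d i) := by
    refine Finset.prod_congr rfl fun i hi => ?_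
    rw [Finset.mem_range] at hi
    rw [Function.update_of_ne (by omega), hq i (by omega), hq' i (by omega)]
  have p3 : queueLength s.1 (Function.update a (n + 1) x) (Function.update d (n + 1) y) (n + 1) =
      nextLength x (historyState n s) := by
    rw [hq _ le_rfl, queueLength, hq' n le_rfl, Function.update_self]
    rfl
  rw [p1, p2, p3]
  ring

/-- The balance equations: `π_Q` is invariant under the transitions of the queue length. -/
lemma sum_piQ_mul_eq (hlam : 0 < lam) (hlt : lam < mu) (hmu : mu < 1) (q : ℕ) :
    ∃ s : Finset (ℕ × Bool × Bool), (∀ t, t ∈ s ↔ nextLength t.2.1 (t.2.2, t.1) = q) ∧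
      ∑ t ∈ s, piQ lam mu t.1 * bernoulliProb lam t.2.1 * serviceProb mu t.2.2 t.1 =
        piQ lam mu q := by
  have h1 : 1 - mu ≠ 0 := by linarith
  have h2 : mu ≠ 0 := by linarith
  have h4 : 1 - lam ≠ 0 := by linarith
  cases q with
  | zero =>
    -- All triples (length, arrival, departure) leading to length 0. Those departing from an empty
    -- queue, one of them through truncated subtraction, have service probability zero.
    refine ⟨{(0, false, false), (0, true, true), (1, false, true), (0, false, true)}, ?_, ?_⟩
    · rintro ⟨q', _ | _, _ | _⟩ <;> simp [nextLength]; omega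
    · rw [Finset.sum_insert (by simp), Finset.sum_insert (by simp), Finset.sum_insert (by simp),
        Finset.sum_singleton]
      simp only [bernoulliProb, serviceProb, piQ_succ, piQ_zero, rho]
      field_simp
      ring
  | succ q =>
    refine ⟨{(q + 1, false, false), (q + 1, true, true), (q + 2, false, true), (q, true, false)},
      ?_, ?_⟩
    · rintro ⟨q', _ | _, _ | _⟩ <;> simp [nextLength]
    · rw [Finset.sum_insert (by simp), Finset.sum_insert (by simp), Finset.sum_insert (by simp),
        Finset.sum_singleton]
      -- Length 1 is separate: its predecessor 0 has its own formulas for `π_Q` and for the service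
      -- probability.
      cases q with
      | zero =>
        simp only [bernoulliProb, serviceProb, piQ_succ, piQ_zero, rho]
        field_simp
        ring
      | succ q =>
        simp only [bernoulliProb, serviceProb, piQ_succ, pow_succ]
        generalize rho lam mu ^ q = r
        unfold rho
        field_simp
        ring

/-- The timing channel in equilibrium is stationary. -/
lemma IsTimingChannel.shift_one [IsFiniteMeasure P] (hlam : 0 < lam) (hlt : lam < mu)
    (hmu : mu < 1) (hch : IsTimingChannel P lam mu Q₀ A D) :
    IsTimingChannel P lam mu (fun ω => (composedState Q₀ A D 1 ω).2) (fun i => A (i + 1))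
      (fun i => D (i + 1)) where
  measurable_init := measurable_snd.comp (hch.measurable_composedState 1)
  measurable_arrival i := hch.measurable_arrival _
  measurable_departure i := hch.measurable_departure _
  law n q a d := by
    set R : ℝ := (∏ i ∈ Finset.Icc 1 n, bernoulliProb lam (a i)) *
      ∏ i ∈ Finset.range (n + 1), serviceProb mu (d i) (queueLength q a d i) with hR
    obtain ⟨s, hs, hsum⟩ := sum_piQ_mul_eq hlam hlt hmu q
    -- The event for the shifted channel is split by the forgotten data `(Q_0, A 1, D 0)`: the bits
    -- `x`, `y` are prepended to `a` and `d`, and the balance equation sums the pieces.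
    let a' : Bool → ℕ → Bool := fun x i => if i = 1 then x else a (i - 1)
    let d' : Bool → ℕ → Bool := fun y i => if i = 0 then y else d (i - 1)
    let cyl : ℕ × Bool × Bool → Set Ω := fun t =>
      {ω | Q₀ ω = t.1 ∧ (∀ i ∈ Finset.Icc 1 (n + 1), A i ω = a' t.2.1 i) ∧
        ∀ i ∈ Finset.range (n + 1 + 1), D i ω = d' t.2.2 i}
    have hcyl : ∀ t ω, ω ∈ cyl t ↔ (Q₀ ω, A 1 ω, D 0 ω) = t ∧
        (∀ i ∈ Finset.Icc 1 n, A (i + 1) ω = a i) ∧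
        ∀ i ∈ Finset.range (n + 1), D (i + 1) ω = d i := by
      rintro ⟨q', x, y⟩ ω
      simp only [cyl, a', d', Set.mem_ofPred_eq, forall_mem_Icc_one_iff, Prod.mk.injEq,
        Finset.mem_range]
      constructor
      · rintro ⟨e1, e2, e3⟩
        refine ⟨⟨e1, by simpa using e2 0 (by omega), by simpa using e3 0 (by omega)⟩,
          fun i hi => by simpa using e2 (i + 1) (by omega),
          fun i hi => by simpa using e3 (i + 1) (by omega)⟩
      · rintro ⟨⟨e1, e2, e3⟩, e4, e5⟩
        refine ⟨e1, fun i hi => ?_, fun i hi => ?_⟩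
        · cases i with
          | zero => simpa using e2
          | succ i => simpa using e4 i (by omega)
        · cases i with
          | zero => simpa using e3
          | succ i => simpa using e5 i (by omega)
    have hlaw : ∀ t ∈ s, P.real (cyl t) =
        piQ lam mu t.1 * bernoulliProb lam t.2.1 * serviceProb mu t.2.2 t.1 * R := by
      rintro ⟨q', x, y⟩ ht
      have hq1 : q' + x.toNat - y.toNat = q := (hs _).1 ht
      have hq : ∀ i, queueLength q' (a' x) (d' y) (i + 1) = queueLength q a d i := by
        intro i
        have : queueLength q' (a' x) (d' y) 1 = q := by
          simp [queueLength, a', d', hq1]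
        rw [queueLength_succ_eq, this]
        exact queueLength_congr (fun j _ => by simp [a']) fun j _ => by simp [d']
      rw [show P.real (cyl (q', x, y)) = _ from hch.law (n + 1) q' (a' x) (d' y),
        prod_Icc_one_eq_prod_range, Finset.prod_range_succ', Finset.prod_range_succ' _ (n + 1), hR,
        prod_Icc_one_eq_prod_range]
      simp only [hq]
      simp only [a', d', queueLength, Nat.add_eq_zero_iff, one_ne_zero, and_false, if_false,
        Nat.add_sub_cancel, zero_add, if_true, Nat.add_eq_right]
      ring
    have hset : {ω | (composedState Q₀ A D 1 ω).2 = q ∧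
        (∀ i ∈ Finset.Icc 1 n, A (i + 1) ω = a i) ∧
        ∀ i ∈ Finset.range (n + 1), D (i + 1) ω = d i} = ⋃ t ∈ s, cyl t := by
      ext ω
      simp only [Set.mem_iUnion, hcyl, exists_prop, Set.mem_ofPred_eq]
      constructor
      · rintro ⟨e1, e2⟩
        exact ⟨_, (hs (Q₀ ω, A 1 ω, D 0 ω)).2 e1, rfl, e2⟩
      · rintro ⟨_, ht, rfl, e2⟩
        exact ⟨(hs _).1 ht, e2⟩
    rw [hset, measureReal_biUnion_finset, Finset.sum_congr rfl hlaw, ← Finset.sum_mul, hsum, hR,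
      mul_assoc]
    · intro t _ t' _ htt
      refine Set.disjoint_left.2 fun ω h h' => htt ?_
      rw [← ((hcyl _ _).1 h).1, ← ((hcyl _ _).1 h').1]
    · intro t _
      have e : cyl t = Q₀ ⁻¹' {t.1} ∩
          ((⋂ i ∈ Finset.Icc 1 (n + 1), A i ⁻¹' {a' t.2.1 i}) ∩
            ⋂ i ∈ Finset.range (n + 1 + 1), D i ⁻¹' {d' t.2.2 i}) := by
        ext ω
        simp only [cyl, Set.mem_inter_iff, Set.mem_iInter, Set.mem_preimage,
          Set.mem_singleton_iff, Set.mem_ofPred_eq]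
      rw [e]
      exact (hch.measurable_init (measurableSet_singleton _)).inter
        ((Finset.measurableSet_biInter _ fun i _ =>
          hch.measurable_arrival i (measurableSet_singleton _)).inter
        (Finset.measurableSet_biInter _ fun i _ =>
          hch.measurable_departure i (measurableSet_singleton _)))

omit [MeasurableSpace Ω] in
lemma composedState_shift_one (i : ℕ) (ω : Ω) :
    composedState (fun ω => (composedState Q₀ A D 1 ω).2) (fun i => A (i + 1))
      (fun i => D (i + 1)) i ω = composedState Q₀ A D (i + 1) ω :=
  Prod.ext rfl (queueLength_succ_eq _ _ _ _).symm

/-- Stationarity on the same space: the states from time `m` on form a channel with the same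
parameters, hence with the same law. -/
lemma IsTimingChannel.exists_shift [IsFiniteMeasure P] (hlam : 0 < lam) (hlt : lam < mu)
    (hmu : mu < 1) (hch : IsTimingChannel P lam mu Q₀ A D) (m : ℕ) :
    ∃ (Q₀' : Ω → ℕ) (A' D' : ℕ → Ω → Bool), IsTimingChannel P lam mu Q₀' A' D' ∧
      ∀ i ω, composedState Q₀' A' D' i ω = composedState Q₀ A D (i + m) ω := by
  induction m with
  | zero => exact ⟨Q₀, A, D, hch, fun _ _ => rfl⟩
  | succ m ih =>
    obtain ⟨Q₀', A', D', h, h'⟩ := ih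
    refine ⟨_, _, _, h.shift_one hlam hlt hmu, fun i ω => ?_⟩
    rw [composedState_shift_one, h', Nat.add_right_comm, Nat.add_assoc]

end Channel

/-! ### Expectations of countably valued variables as series -/

section Countable

variable {Ω X : Type*} [MeasurableSpace Ω] {P : Measure Ω} [IsFiniteMeasure P]
  [MeasurableSpace X] [Countable X] [MeasurableSingletonClass X] {Z : Ω → X} {h : X → ℝ}

omit [IsFiniteMeasure P] in
lemma map_eq_sum_dirac (hZ : Measurable Z) :
    P.map Z = Measure.sum fun x => P (Z ⁻¹' {x}) • Measure.dirac x := by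
  rw [← Measure.sum_smul_dirac (P.map Z)]
  congr 1
  ext1 x
  rw [Measure.map_apply hZ (measurableSet_singleton x)]

lemma integrable_comp_of_summable (hZ : Measurable Z)
    (hs : Summable fun x => P.real (Z ⁻¹' {x}) * |h x|) : Integrable (fun ω => h (Z ω)) P := by
  refine (integrable_map_measure Measurable.of_discrete.aestronglyMeasurable hZ.aemeasurable).1 ?_
  rw [map_eq_sum_dirac hZ]
  exact integrable_sum_dirac (fun x => measure_ne_top _ _) hs

lemma hasSum_integral_comp (hZ : Measurable Z) (hi : Integrable (fun ω => h (Z ω)) P) :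
    HasSum (fun x => P.real (Z ⁻¹' {x}) * h x) (∫ ω, h (Z ω) ∂P) := by
  have hi' := (integrable_map_measure (f := Z) (g := h)
    Measurable.of_discrete.aestronglyMeasurable hZ.aemeasurable).2 hi
  rw [← integral_map hZ.aemeasurable Measurable.of_discrete.aestronglyMeasurable (f := h)]
  rw [map_eq_sum_dirac hZ] at hi' ⊢
  exact hasSum_integral_sum_dirac (fun x => measure_ne_top _ _) hi'.summable_of_dirac

end Countable

/-! ### Bounds for the one-step conditional means -/

section Service

variable {lam mu : ℝ}

lemma serviceProb_nonneg (hmu0 : 0 ≤ mu) (hmu : mu ≤ 1) (y : Bool) (q : ℕ) :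
    0 ≤ serviceProb mu y q := by
  rcases y with _ | _ <;> rcases q with _ | q <;> simp [serviceProb] <;> linarith

lemma serviceProb_add (mu : ℝ) (q : ℕ) : serviceProb mu false q + serviceProb mu true q = 1 := by
  cases q <;> simp [serviceProb]

lemma bernoulliProb_nonneg (hlam0 : 0 ≤ lam) (hlam : lam ≤ 1) (x : Bool) :
    0 ≤ bernoulliProb lam x := by
  cases x <;> simp [bernoulliProb] <;> linarith

lemma serviceMean_const (mu c : ℝ) (q : ℕ) : serviceMean mu (fun _ => c) q = c := by
  rw [serviceMean, ← add_mul, serviceProb_add, one_mul]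

lemma serviceMean_comp_snd (mu : ℝ) (h : ℕ → ℝ) : serviceMean mu (fun s => h s.2) = h :=
  funext fun q => serviceMean_const mu (h q) q

lemma abs_serviceMean_le (hmu0 : 0 ≤ mu) (hmu : mu ≤ 1) {φ : Bool × ℕ → ℝ} {q : ℕ} {c : ℝ}
    (hφ : ∀ y, |φ (y, q)| ≤ c) : |serviceMean mu φ q| ≤ c := by
  have h0 := serviceProb_nonneg hmu0 hmu false q
  have h1 := serviceProb_nonneg hmu0 hmu true q
  calc _ ≤ serviceProb mu false q * |φ (false, q)| + serviceProb mu true q * |φ (true, q)| := by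
        refine (abs_add_le _ _).trans_eq ?_
        rw [abs_mul, abs_mul, abs_of_nonneg h0, abs_of_nonneg h1]
    _ ≤ serviceProb mu false q * c + serviceProb mu true q * c := by
        gcongr
        · exact hφ _
        · exact hφ _
    _ = c := by rw [← add_mul, serviceProb_add, one_mul]

lemma abs_arrivalMean_le (hlam0 : 0 ≤ lam) (hlam : lam ≤ 1) {h : ℕ → ℝ} {a b : ℝ} (hb : 0 ≤ b)
    (hh : ∀ q, |h q| ≤ a + b * q) (s : Bool × ℕ) :
    |arrivalMean lam h s| ≤ (a + b) + b * s.2 := by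
  have h0 : |h (s.2 - s.1.toNat)| ≤ (a + b) + b * s.2 := by
    refine (hh _).trans ?_
    have : ((s.2 - s.1.toNat : ℕ) : ℝ) ≤ s.2 := by exact_mod_cast Nat.sub_le _ _
    nlinarith
  have h1 : |h (s.2 + 1 - s.1.toNat)| ≤ (a + b) + b * s.2 := by
    refine (hh _).trans ?_
    have : ((s.2 + 1 - s.1.toNat : ℕ) : ℝ) ≤ s.2 + 1 := by exact_mod_cast Nat.sub_le _ _
    nlinarith
  calc _ ≤ (1 - lam) * |h (s.2 - s.1.toNat)| + lam * |h (s.2 + 1 - s.1.toNat)| := by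
        refine (abs_add_le _ _).trans_eq ?_
        rw [abs_mul, abs_mul, abs_of_nonneg hlam0, abs_of_nonneg (sub_nonneg.2 hlam)]
    _ ≤ (1 - lam) * ((a + b) + b * s.2) + lam * ((a + b) + b * s.2) := by
        gcongr
    _ = _ := by ring

/-- A step adds at most one customer. The factor `1 *` matches the shape `a + b * q` of the
integrability lemmas. -/
lemma abs_queueStep_iterate_le (hlam0 : 0 ≤ lam) (hlam : lam ≤ 1) (hmu0 : 0 ≤ mu) (hmu : mu ≤ 1)
    (n q : ℕ) : |(queueStep lam mu)^[n] Nat.cast q| ≤ n + 1 * q := by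
  induction n generalizing q with
  | zero => simp
  | succ n ih =>
    rw [Function.iterate_succ_apply']
    refine abs_serviceMean_le hmu0 hmu fun y => ?_
    push_cast
    exact abs_arrivalMean_le hlam0 hlam zero_le_one ih (y, q)

lemma sum_bernoulliProb_mul_serviceProb_mul (lam mu : ℝ) (ψ : Bool × ℕ → ℝ) (s : Bool × ℕ) :
    ∑ z : Bool × Bool, bernoulliProb lam z.1 * serviceProb mu z.2 (nextLength z.1 s) *
      ψ (z.2, nextLength z.1 s) = arrivalMean lam (serviceMean mu ψ) s := by
  simp only [Fintype.sum_prod_type, Fintype.sum_bool, arrivalMean, serviceMean, nextLength,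
    bernoulliProb, Bool.toNat_true, Bool.toNat_false, add_zero]
  ring

end Service

/-! ### Markov property -/

section Channel

variable {Ω : Type*} [MeasurableSpace Ω] {P : Measure Ω} [IsProbabilityMeasure P] {lam mu : ℝ}
  {Q₀ : Ω → ℕ} {A D : ℕ → Ω → Bool}

lemma IsTimingChannel.integral_pair_eq (hch : IsTimingChannel P lam mu Q₀ A D)
    {Q₀' : Ω → ℕ} {A' D' : ℕ → Ω → Bool} (hch' : IsTimingChannel P lam mu Q₀' A' D')
    (G : Bool × ℕ → Bool × ℕ → ℝ) (n : ℕ) :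
    ∫ ω, G (composedState Q₀ A D 0 ω) (composedState Q₀ A D n ω) ∂P =
      ∫ ω, G (composedState Q₀' A' D' 0 ω) (composedState Q₀' A' D' n ω) ∂P := by
  simp only [← historyState_history (Nat.zero_le n), ← historyState_history (le_refl n)]
  rw [← integral_map (hch.measurable_history n).aemeasurable
      (f := fun s => G (historyState 0 s) (historyState n s))
      Measurable.of_discrete.aestronglyMeasurable,
    ← integral_map (hch'.measurable_history n).aemeasurable
      (f := fun s => G (historyState 0 s) (historyState n s))
      Measurable.of_discrete.aestronglyMeasurable, hch.map_history_eq hch']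

/-- Given the past, the next arrival and the next departure have the prescribed conditional
probabilities. -/
lemma IsTimingChannel.setIntegral_next (hlam : 0 < lam) (hlt : lam < mu) (hmu : mu < 1)
    (hch : IsTimingChannel P lam mu Q₀ A D) (n : ℕ)
    (G : Bool × ℕ → Bool × ℕ → ℝ) (x y : Bool) :
    ∫ ω in {ω | A (n + 1) ω = x ∧ D (n + 1) ω = y},
        G (composedState Q₀ A D 0 ω) (composedState Q₀ A D n ω) ∂P =
      ∫ ω, bernoulliProb lam x * serviceProb mu y (nextLength x (composedState Q₀ A D n ω)) *
        G (composedState Q₀ A D 0 ω) (composedState Q₀ A D n ω) ∂P := by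
  have hH := hch.measurable_history n
  set E : Set Ω := {ω | A (n + 1) ω = x ∧ D (n + 1) ω = y} with hE
  let w : ℕ × (Fin n → Bool) × (Fin (n + 1) → Bool) → ℝ := fun s =>
    bernoulliProb lam x * serviceProb mu y (nextLength x (historyState n s))
  have hw : ∀ s, 0 ≤ w s := fun s =>
    mul_nonneg (bernoulliProb_nonneg hlam.le (by linarith) x)
      (serviceProb_nonneg (by linarith) hmu.le y _)
  have hwm : Measurable fun ω => ENNReal.ofReal (w (history Q₀ A D n ω)) :=
    ENNReal.measurable_ofReal.comp ((Measurable.of_discrete (f := w)).comp hH)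
  -- Restricting to the event and weighting by its conditional probability give the same measure on
  -- histories; singletons suffice by countability.
  have hmap : (P.restrict E).map (history Q₀ A D n) =
      (P.withDensity fun ω => ENNReal.ofReal (w (history Q₀ A D n ω))).map
        (history Q₀ A D n) := by
    refine Measure.ext_of_singleton fun s => ?_
    have hs := hH (measurableSet_singleton s)
    rw [Measure.map_apply hH (measurableSet_singleton s),
      Measure.map_apply hH (measurableSet_singleton s), Measure.restrict_apply hs,
      withDensity_apply _ hs, setLIntegral_congr_fun hs (g := fun _ => ENNReal.ofReal (w s))
        (fun ω hω => by rw [show history Q₀ A D n ω = s from hω]),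
      setLIntegral_const, ← ofReal_measureReal, ← ofReal_measureReal,
      ← ENNReal.ofReal_mul (hw s), hch.measureReal_history_inter]
  simp only [← historyState_history (Nat.zero_le n), ← historyState_history (le_refl n)]
  rw [← integral_map hH.aemeasurable (f := fun s => G (historyState 0 s) (historyState n s))
      Measurable.of_discrete.aestronglyMeasurable, hmap,
    integral_map hH.aemeasurable Measurable.of_discrete.aestronglyMeasurable,
    integral_withDensity_eq_integral_toReal_smul hwm
      (Eventually.of_forall fun ω => ENNReal.ofReal_lt_top)]
  refine integral_congr_ae (Eventually.of_forall fun ω => ?_)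
  simp only [smul_eq_mul, ENNReal.toReal_ofReal (hw _)]
  rfl

omit [IsProbabilityMeasure P] in
lemma IsTimingChannel.measureReal_composedState_zero (hch : IsTimingChannel P lam mu Q₀ A D)
    (s : Bool × ℕ) :
    P.real (composedState Q₀ A D 0 ⁻¹' {s}) = piQ lam mu s.2 * serviceProb mu s.1 s.2 := by
  have h := hch.law 0 s.2 (fun _ => false) (fun _ => s.1)
  simp only [Finset.Icc_eq_empty_of_lt zero_lt_one, Finset.prod_empty, zero_add, mul_one,
    Finset.prod_range_one, queueLength] at h
  rw [← h]
  congr 1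
  ext ω
  simp [composedState, queueLength, Prod.ext_iff, and_comm]

lemma IsTimingChannel.integrable_zero (hlam : 0 < lam) (hlt : lam < mu) (hmu : mu < 1)
    (hch : IsTimingChannel P lam mu Q₀ A D) {h : ℕ → ℝ}
    (hs : Summable fun q => |h q| * piQ lam mu q) :
    Integrable (fun ω => h (composedState Q₀ A D 0 ω).2) P := by
  refine integrable_comp_of_summable (Z := composedState Q₀ A D 0) (h := fun s => h s.2)
    (hch.measurable_composedState 0) ?_
  simp only [hch.measureReal_composedState_zero]
  rw [← (Equiv.prodComm ℕ Bool).summable_iff]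
  have hn : ∀ y q, 0 ≤ piQ lam mu q * serviceProb mu y q * |h q| := fun y q =>
    mul_nonneg (mul_nonneg (piQ_nonneg hlam hlt hmu q)
      (serviceProb_nonneg (by linarith) hmu.le y q)) (abs_nonneg _)
  refine (summable_prod_of_nonneg fun z => hn z.2 z.1).2 ⟨fun q => Summable.of_finite, ?_⟩
  refine hs.congr fun q => ?_
  simp only [tsum_bool]
  rw [← add_mul, ← mul_add, serviceProb_add]
  ring

lemma IsTimingChannel.hasSum_integral_zero (hch : IsTimingChannel P lam mu Q₀ A D)
    {χ : Bool × ℕ → ℝ} (hi : Integrable (fun ω => χ (composedState Q₀ A D 0 ω)) P) :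
    HasSum (fun q => serviceMean mu χ q * piQ lam mu q)
      (∫ ω, χ (composedState Q₀ A D 0 ω) ∂P) := by
  have h := hasSum_integral_comp (hch.measurable_composedState 0) hi
  rw [← (Equiv.prodComm ℕ Bool).hasSum_iff] at h
  refine (h.prod_fiberwise fun q => hasSum_fintype _).congr_fun fun q => ?_
  simp only [Function.comp_apply, Equiv.prodComm_apply, Prod.swap_prod_mk, Fintype.sum_bool,
    hch.measureReal_composedState_zero, serviceMean]
  ring

omit [MeasurableSpace Ω] in
lemma composedState_snd_le (n : ℕ) (ω : Ω) :
    (composedState Q₀ A D n ω).2 ≤ (composedState Q₀ A D 0 ω).2 + n :=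
  queueLength_le _ _ _ n

/-- `Q_n ≤ Q_0 + n` reduces this to the finite mean of `π_Q`. -/
lemma IsTimingChannel.integrable_mul (hlam : 0 < lam) (hlt : lam < mu) (hmu : mu < 1)
    (hch : IsTimingChannel P lam mu Q₀ A D) (n : ℕ) {φ ψ : Bool × ℕ → ℝ} {B a b : ℝ}
    (hb : 0 ≤ b) (hφ : ∀ s, |φ s| ≤ B) (hψ : ∀ s, |ψ s| ≤ a + b * s.2) :
    Integrable (fun ω => φ (composedState Q₀ A D 0 ω) * ψ (composedState Q₀ A D n ω)) P := by
  have hQ : Integrable (fun ω => ((composedState Q₀ A D 0 ω).2 : ℝ)) P := by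
    refine hch.integrable_zero hlam hlt hmu (h := Nat.cast) ?_
    simpa using (hasSum_natCast_mul_piQ hlam hlt hmu).summable
  have hi : Integrable (fun ω => ψ (composedState Q₀ A D n ω)) P := by
    refine ((integrable_const (a + b * n)).add (hQ.const_mul b)).mono'
      ((Measurable.of_discrete (f := ψ)).comp
        (hch.measurable_composedState n)).aestronglyMeasurable
      (Eventually.of_forall fun ω => (hψ _).trans ?_)
    have : ((composedState Q₀ A D n ω).2 : ℝ) ≤ (composedState Q₀ A D 0 ω).2 + n := by
      exact_mod_cast composedState_snd_le n ω
    simp only [Pi.add_apply]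
    nlinarith
  exact hi.bdd_mul (c := B) ((Measurable.of_discrete (f := φ)).comp
    (hch.measurable_composedState 0)).aestronglyMeasurable (Eventually.of_forall fun ω => hφ _)

/-- The Markov property of the composed state. -/
lemma IsTimingChannel.integral_mul_succ (hlam : 0 < lam) (hlt : lam < mu) (hmu : mu < 1)
    (hch : IsTimingChannel P lam mu Q₀ A D) (n : ℕ) {φ ψ : Bool × ℕ → ℝ} {B a b : ℝ}
    (hb : 0 ≤ b) (hφ : ∀ s, |φ s| ≤ B) (hψ : ∀ s, |ψ s| ≤ a + b * s.2) :
    ∫ ω, φ (composedState Q₀ A D 0 ω) * ψ (composedState Q₀ A D (n + 1) ω) ∂P =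
      ∫ ω, φ (composedState Q₀ A D 0 ω) *
        arrivalMean lam (serviceMean mu ψ) (composedState Q₀ A D n ω) ∂P := by
  -- The four values of the next arrival and departure partition `Ω`; on each piece `Ψ_{n+1}` is a
  -- function of `Ψ_n`.
  let E : Bool × Bool → Set Ω := fun z => {ω | A (n + 1) ω = z.1 ∧ D (n + 1) ω = z.2}
  have hEm : ∀ z, MeasurableSet (E z) := fun z =>
    (hch.measurable_arrival (n + 1) (measurableSet_singleton z.1)).inter
      (hch.measurable_departure (n + 1) (measurableSet_singleton z.2))
  have hEd : Pairwise (Function.onFun Disjoint E) := by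
    intro z z' hz
    refine Set.disjoint_left.2 fun ω h h' => hz (Prod.ext ?_ ?_)
    · exact h.1.symm.trans h'.1
    · exact h.2.symm.trans h'.2
  have hEu : ⋃ z, E z = Set.univ :=
    Set.eq_univ_of_forall fun ω => Set.mem_iUnion.2 ⟨(A (n + 1) ω, D (n + 1) ω), rfl, rfl⟩
  have hi := hch.integrable_mul hlam hlt hmu (n + 1) hb hφ hψ
  have hnext : ∀ (z : Bool × Bool) (s : Bool × ℕ), |ψ (z.2, nextLength z.1 s)| ≤ (a + b) + b * s.2 := by
    intro z s
    refine (hψ _).trans ?_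
    have h1 := Bool.toNat_le z.1
    have : ((nextLength z.1 s : ℕ) : ℝ) ≤ s.2 + 1 := by
      have : nextLength z.1 s ≤ s.2 + 1 := by unfold nextLength; omega
      exact_mod_cast this
    dsimp only
    nlinarith
  have hterm : ∀ z : Bool × Bool, Integrable (fun ω => φ (composedState Q₀ A D 0 ω) *
      (bernoulliProb lam z.1 * serviceProb mu z.2 (nextLength z.1 (composedState Q₀ A D n ω)) *
        ψ (z.2, nextLength z.1 (composedState Q₀ A D n ω)))) P := by
    intro z
    refine hch.integrable_mul hlam hlt hmu n (ψ := fun s => bernoulliProb lam z.1 *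
      serviceProb mu z.2 (nextLength z.1 s) * ψ (z.2, nextLength z.1 s)) (a := a + b) hb hφ
      fun s => ?_
    have h1 : |bernoulliProb lam z.1 * serviceProb mu z.2 (nextLength z.1 s)| ≤ 1 := by
      have b1 := bernoulliProb_nonneg hlam.le (hlt.trans hmu).le
      have b2 : bernoulliProb lam z.1 ≤ 1 := by
        cases z.1 <;> simp only [bernoulliProb] <;> linarith
      have s1 := serviceProb_nonneg (hlam.trans hlt).le hmu.le
      have s2 : serviceProb mu z.2 (nextLength z.1 s) ≤ 1 := by
        have h0 := serviceProb_add mu (nextLength z.1 s)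
        have h1 := s1 false (nextLength z.1 s)
        have h2 := s1 true (nextLength z.1 s)
        cases z.2 <;> linarith
      rw [abs_of_nonneg (mul_nonneg (b1 _) (s1 _ _))]
      exact mul_le_one₀ b2 (s1 _ _) s2
    rw [abs_mul]
    exact (mul_le_of_le_one_left (abs_nonneg _) h1).trans (hnext z s)
  calc _ = ∑ z, ∫ ω in E z, φ (composedState Q₀ A D 0 ω) *
          ψ (composedState Q₀ A D (n + 1) ω) ∂P := by
        rw [← integral_iUnion_fintype hEm hEd fun z => hi.integrableOn, hEu, Measure.restrict_univ]
    _ = ∑ z : Bool × Bool, ∫ ω in E z, φ (composedState Q₀ A D 0 ω) *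
          ψ (z.2, nextLength z.1 (composedState Q₀ A D n ω)) ∂P := by
        refine Finset.sum_congr rfl fun z _ => setIntegral_congr_fun (hEm z) fun ω hω => ?_
        have : composedState Q₀ A D (n + 1) ω = (z.2, nextLength z.1 (composedState Q₀ A D n ω)) := by
          rw [← hω.1, ← hω.2]
          rfl
        rw [this]
    _ = ∑ z : Bool × Bool, ∫ ω, φ (composedState Q₀ A D 0 ω) * (bernoulliProb lam z.1 *
          serviceProb mu z.2 (nextLength z.1 (composedState Q₀ A D n ω)) *
          ψ (z.2, nextLength z.1 (composedState Q₀ A D n ω))) ∂P := by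
        refine Finset.sum_congr rfl fun z _ => ?_
        refine (hch.setIntegral_next hlam hlt hmu n
          (fun s t => φ s * ψ (z.2, nextLength z.1 t)) z.1 z.2).trans ?_
        refine integral_congr_ae (Eventually.of_forall fun ω => ?_)
        dsimp only
        ring
    _ = _ := by
        rw [← integral_finsetSum _ fun z _ => hterm z]
        simp only [← Finset.mul_sum, sum_bernoulliProb_mul_serviceProb_mul]

/-- Both sides have the same conditional mean one step earlier. The time must be at least 1, since
`φ (Ψ_0)` already depends on the departure at time 0. -/
lemma IsTimingChannel.integral_mul_serviceMean (hlam : 0 < lam) (hlt : lam < mu) (hmu : mu < 1)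
    (hch : IsTimingChannel P lam mu Q₀ A D) (n : ℕ) {φ ψ : Bool × ℕ → ℝ} {B a b : ℝ}
    (hb : 0 ≤ b) (hφ : ∀ s, |φ s| ≤ B) (hψ : ∀ s, |ψ s| ≤ a + b * s.2) :
    ∫ ω, φ (composedState Q₀ A D 0 ω) * ψ (composedState Q₀ A D (n + 1) ω) ∂P =
      ∫ ω, φ (composedState Q₀ A D 0 ω) *
        serviceMean mu ψ (composedState Q₀ A D (n + 1) ω).2 ∂P := by
  rw [hch.integral_mul_succ hlam hlt hmu n hb hφ hψ,
    hch.integral_mul_succ hlam hlt hmu n (ψ := fun s => serviceMean mu ψ s.2) hb hφ fun s =>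
      abs_serviceMean_le (by linarith) hmu.le fun y => hψ (y, s.2), serviceMean_comp_snd]

/-- The Markov property of the queue length. -/
lemma IsTimingChannel.integral_mul_queueStep (hlam : 0 < lam) (hlt : lam < mu) (hmu : mu < 1)
    (hch : IsTimingChannel P lam mu Q₀ A D) (n : ℕ) {φ : Bool × ℕ → ℝ} {h : ℕ → ℝ} {B a b : ℝ}
    (hb : 0 ≤ b) (hφ : ∀ s, |φ s| ≤ B) (hh : ∀ q, |h q| ≤ a + b * q) :
    ∫ ω, φ (composedState Q₀ A D 0 ω) * h (composedState Q₀ A D (n + 2) ω).2 ∂P =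
      ∫ ω, φ (composedState Q₀ A D 0 ω) *
        queueStep lam mu h (composedState Q₀ A D (n + 1) ω).2 ∂P := by
  rw [hch.integral_mul_succ hlam hlt hmu (n + 1) (ψ := fun s => h s.2) hb hφ fun s => hh s.2,
    serviceMean_comp_snd, hch.integral_mul_serviceMean hlam hlt hmu n hb hφ
      (abs_arrivalMean_le hlam.le (by linarith) hb hh)]
  rfl

lemma IsTimingChannel.integral_mul_queueLength (hlam : 0 < lam) (hlt : lam < mu) (hmu : mu < 1)
    (hch : IsTimingChannel P lam mu Q₀ A D) (n : ℕ) {φ : Bool × ℕ → ℝ} {B : ℝ}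
    (hφ : ∀ s, |φ s| ≤ B) :
    ∫ ω, φ (composedState Q₀ A D 0 ω) * ((composedState Q₀ A D (n + 1) ω).2 : ℝ) ∂P =
      ∫ ω, φ (composedState Q₀ A D 0 ω) *
        (queueStep lam mu)^[n] Nat.cast (composedState Q₀ A D 1 ω).2 ∂P := by
  -- Each use of the Markov property trades one unit of time for one application of the operator,
  -- stopping at time 1.
  suffices H : ∀ k m, m + k = n →
      ∫ ω, φ (composedState Q₀ A D 0 ω) * ((composedState Q₀ A D (n + 1) ω).2 : ℝ) ∂P =
      ∫ ω, φ (composedState Q₀ A D 0 ω) *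
        (queueStep lam mu)^[k] Nat.cast (composedState Q₀ A D (m + 1) ω).2 ∂P from
    H n 0 (zero_add n)
  intro k
  induction k with
  | zero => rintro m rfl; rfl
  | succ k ih =>
    intro m hm
    rw [ih (m + 1) (by omega), hch.integral_mul_queueStep hlam hlt hmu m zero_le_one hφ
      (abs_queueStep_iterate_le hlam.le (by linarith) (by linarith) hmu.le k),
      Function.iterate_succ_apply']

end Channel

/-! ### Covariances: decay, telescoping and explicit values -/

section Channel

variable {Ω : Type*} [MeasurableSpace Ω] {P : Measure Ω} [IsProbabilityMeasure P] {lam mu : ℝ}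
  {Q₀ : Ω → ℕ} {A D : ℕ → Ω → Bool}

/-- The covariance of `φ (Ψ_0)` and the queue length at time `n`. -/
def lengthCov (P : Measure Ω) (Q₀ : Ω → ℕ) (A D : ℕ → Ω → Bool) (φ : Bool × ℕ → ℝ) (n : ℕ) : ℝ :=
  ∫ ω, φ (composedState Q₀ A D 0 ω) * ((composedState Q₀ A D n ω).2 : ℝ) ∂P -
    (∫ ω, φ (composedState Q₀ A D 0 ω) ∂P) * ∫ ω, ((composedState Q₀ A D n ω).2 : ℝ) ∂P

/-- `Q_{n+1}` can be replaced by `T^n id (Q_1)`, and subtracting the constant `T^n id 0` leaves the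
covariance unchanged. What remains is at most `γ^n` times an integrable weight. -/
lemma IsTimingChannel.exists_abs_lengthCov_le (hlam : 0 < lam) (hlt : lam < mu) (hmu : mu < 1)
    (hch : IsTimingChannel P lam mu Q₀ A D) {φ : Bool × ℕ → ℝ} {B : ℝ} (hφ : ∀ s, |φ s| ≤ B) :
    ∃ K γ : ℝ, 0 ≤ γ ∧ γ < 1 ∧ ∀ n, |lengthCov P Q₀ A D φ (n + 1)| ≤ K * γ ^ n := by
  obtain ⟨θ, γ, h1θ, hθr, hγ0, hγ1, hdiff⟩ := exists_abs_queueStep_iterate_sub_le hlam hlt hmu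
  have hB : 0 ≤ B := (abs_nonneg _).trans (hφ (true, 0))
  have hθ0 : 0 < θ - 1 := by linarith
  -- Summing the increment bounds: the geometric sum of `θ^j` over `j < q` is at most `θ^q / (θ -
  -- 1)`.
  have hosc : ∀ n q, |(queueStep lam mu)^[n] Nat.cast q - (queueStep lam mu)^[n] Nat.cast 0| ≤
      γ ^ n * (θ ^ q / (θ - 1)) := by
    intro n q
    induction q with
    | zero =>
      rw [sub_self, abs_zero]
      positivity
    | succ q ih =>
      calc _ ≤ _ := abs_sub_le _ ((queueStep lam mu)^[n] Nat.cast q) _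
        _ ≤ γ ^ n * θ ^ q + γ ^ n * (θ ^ q / (θ - 1)) := add_le_add (hdiff n q) ih
        _ = _ := by field_simp; ring
  -- The exponent `Q_0 + 1` dominates `Q_1`, and the law of `Q_0` is `π_Q`.
  let w : Ω → ℝ := fun ω => θ ^ ((composedState Q₀ A D 0 ω).2 + 1) / (θ - 1)
  have hw : Integrable w P := by
    refine hch.integrable_zero hlam hlt hmu (h := fun q => θ ^ (q + 1) / (θ - 1)) ?_
    refine ((summable_pow_mul_piQ hlam hlt hmu (by linarith) hθr).mul_left (θ / (θ - 1))).congr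
      fun q => ?_
    rw [abs_of_nonneg (by positivity)]
    ring
  have hw0 : ∀ ω, 0 ≤ w ω := fun ω => by
    have : 0 < θ := by linarith
    positivity
  refine ⟨2 * B * ∫ ω, w ω ∂P, γ, hγ0, hγ1, fun n => ?_⟩
  set h := (queueStep lam mu)^[n] Nat.cast with hh
  have hbd := abs_queueStep_iterate_le hlam.le (hlt.trans hmu).le (hlam.trans hlt).le hmu.le n
  rw [← hh] at hbd
  let v : Ω → ℝ := fun ω => h (composedState Q₀ A D 1 ω).2 - h 0
  have hv : ∀ ω, |v ω| ≤ γ ^ n * w ω := by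
    intro ω
    refine (hosc n _).trans ?_
    dsimp only [w]
    gcongr
    · exact h1θ.le
    · exact composedState_snd_le 1 ω
  have hone : ∀ s : Bool × ℕ, |(fun _ => (1 : ℝ)) s| ≤ 1 := fun s => by simp
  have hi1 := hch.integrable_mul hlam hlt hmu 1 (ψ := fun s => h s.2) zero_le_one hφ
    fun s => hbd s.2
  have hi2 := hch.integrable_mul hlam hlt hmu 1 (φ := fun _ => 1) (ψ := fun s => h s.2)
    zero_le_one hone fun s => hbd s.2
  have hi3 := hch.integrable_mul hlam hlt hmu 1 (ψ := fun _ => 1) (a := 1) le_rfl hφ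
    fun s => by simp
  simp only [one_mul, mul_one] at hi2 hi3
  have e1 := hch.integral_mul_queueLength hlam hlt hmu n hφ
  have e2 := hch.integral_mul_queueLength hlam hlt hmu n hone
  simp only [one_mul] at e2
  have e : lengthCov P Q₀ A D φ (n + 1) = ∫ ω, φ (composedState Q₀ A D 0 ω) * v ω ∂P -
      (∫ ω, φ (composedState Q₀ A D 0 ω) ∂P) * ∫ ω, v ω ∂P := by
    rw [lengthCov, e1, e2]
    simp only [v, mul_sub]
    rw [integral_sub hi1 (hi3.mul_const _), integral_sub hi2 (integrable_const _),
      integral_mul_const, integral_const, probReal_univ, one_smul]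
    ring
  have b1 : |∫ ω, φ (composedState Q₀ A D 0 ω) * v ω ∂P| ≤ B * (γ ^ n * ∫ ω, w ω ∂P) := by
    rw [← integral_const_mul, ← integral_const_mul, ← Real.norm_eq_abs]
    refine norm_integral_le_of_norm_le ((hw.const_mul _).const_mul _)
      (Eventually.of_forall fun ω => ?_)
    rw [Real.norm_eq_abs, abs_mul]
    exact mul_le_mul (hφ _) (hv ω) (abs_nonneg _) hB
  have b2 : |∫ ω, v ω ∂P| ≤ γ ^ n * ∫ ω, w ω ∂P := by
    rw [← integral_const_mul, ← Real.norm_eq_abs]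
    exact norm_integral_le_of_norm_le (hw.const_mul _) (Eventually.of_forall hv)
  have b3 : |∫ ω, φ (composedState Q₀ A D 0 ω) ∂P| ≤ B := by
    rw [← Real.norm_eq_abs]
    refine (norm_integral_le_of_norm_le_const (C := B)
      (Eventually.of_forall fun ω => hφ _)).trans_eq ?_
    rw [probReal_univ, mul_one]
  rw [e]
  calc _ ≤ _ := abs_sub _ _
    _ ≤ B * (γ ^ n * ∫ ω, w ω ∂P) + B * (γ ^ n * ∫ ω, w ω ∂P) := by
      rw [abs_mul]
      exact add_le_add b1 (mul_le_mul b3 b2 (abs_nonneg _) hB)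
    _ = _ := by ring

lemma IsTimingChannel.integral_mul_infoDensity (hlam : 0 < lam) (hlt : lam < mu) (hmu : mu < 1)
    (hch : IsTimingChannel P lam mu Q₀ A D) {φ : Bool × ℕ → ℝ} {B : ℝ} (hφ : ∀ s, |φ s| ≤ B)
    (n : ℕ) :
    ∫ ω, φ (composedState Q₀ A D 0 ω) *
        infoDensity lam mu (composedState Q₀ A D (n + 1) ω) ∂P =
      capacityC lam mu * ∫ ω, φ (composedState Q₀ A D 0 ω) ∂P + poissonSlope lam mu *
        (∫ ω, φ (composedState Q₀ A D 0 ω) * ((composedState Q₀ A D (n + 1) ω).2 : ℝ) ∂P -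
          ∫ ω, φ (composedState Q₀ A D 0 ω) * ((composedState Q₀ A D (n + 2) ω).2 : ℝ) ∂P) := by
  obtain ⟨M, hM0, hM⟩ := exists_abs_infoDensity_le hlam hlt hmu
  have hbd := abs_queueStep_iterate_le hlam.le (hlt.trans hmu).le (hlam.trans hlt).le hmu.le
  have h0 : ∀ q : ℕ, |(q : ℝ)| ≤ (0 : ℕ) + 1 * q := hbd 0
  rw [hch.integral_mul_serviceMean hlam hlt hmu n (a := M) le_rfl hφ (by simpa using hM),
    hch.integral_mul_queueStep hlam hlt hmu n zero_le_one hφ h0]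
  have hi1 := hch.integrable_mul hlam hlt hmu (n + 1) (ψ := fun s => (s.2 : ℝ)) zero_le_one hφ
    fun s => h0 s.2
  have hi2 := hch.integrable_mul hlam hlt hmu (n + 1)
    (ψ := fun s => queueStep lam mu Nat.cast s.2) zero_le_one hφ fun s => hbd 1 s.2
  have hi3 := hch.integrable_mul hlam hlt hmu 0 (ψ := fun _ => 1) (a := 1) le_rfl hφ
    fun s => by simp
  simp only [mul_one] at hi3
  rw [← integral_sub hi1 hi2, ← integral_const_mul, ← integral_const_mul]
  refine Eq.trans ?_ (integral_add (hi3.const_mul _) ((hi1.sub hi2).const_mul _))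
  refine integral_congr_ae (Eventually.of_forall fun ω => ?_)
  dsimp only
  rw [serviceMean_infoDensity_eq hlam hlt hmu]
  ring

lemma IsTimingChannel.memLp_infoDensity (hlam : 0 < lam) (hlt : lam < mu) (hmu : mu < 1)
    (hch : IsTimingChannel P lam mu Q₀ A D) (n : ℕ) :
    MemLp (fun ω => infoDensity lam mu (composedState Q₀ A D n ω)) 2 P := by
  obtain ⟨M, hM0, hM⟩ := exists_abs_infoDensity_le hlam hlt hmu
  exact MemLp.of_bound ((Measurable.of_discrete (f := infoDensity lam mu)).comp
    (hch.measurable_composedState n)).aestronglyMeasurable M (Eventually.of_forall fun ω => hM _)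

/-- The integrated Poisson equation is used with `φ = f` and with `φ = 1`; the terms in `C` cancel.
-/
lemma IsTimingChannel.covariance_infoDensity_succ (hlam : 0 < lam) (hlt : lam < mu) (hmu : mu < 1)
    (hch : IsTimingChannel P lam mu Q₀ A D) (n : ℕ) :
    cov[fun ω => infoDensity lam mu (composedState Q₀ A D 0 ω),
      fun ω => infoDensity lam mu (composedState Q₀ A D (n + 1) ω); P] =
      poissonSlope lam mu * (lengthCov P Q₀ A D (infoDensity lam mu) (n + 1) -
        lengthCov P Q₀ A D (infoDensity lam mu) (n + 2)) := by
  obtain ⟨M, hM0, hM⟩ := exists_abs_infoDensity_le hlam hlt hmu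
  have h1 := hch.integral_mul_infoDensity hlam hlt hmu hM n
  have h2 := hch.integral_mul_infoDensity hlam hlt hmu (φ := fun _ => 1) (B := 1) (by simp) n
  simp only [one_mul, integral_const, probReal_univ, one_smul, mul_one] at h2
  rw [covariance_eq_sub (hch.memLp_infoDensity hlam hlt hmu 0)
    (hch.memLp_infoDensity hlam hlt hmu (n + 1)), lengthCov, lengthCov]
  simp only [Pi.mul_apply]
  rw [h1, h2]
  ring

lemma IsTimingChannel.integral_infoDensity_zero (hlam : 0 < lam) (hlt : lam < mu) (hmu : mu < 1)
    (hch : IsTimingChannel P lam mu Q₀ A D) :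
    ∫ ω, infoDensity lam mu (composedState Q₀ A D 0 ω) ∂P = capacityC lam mu := by
  rw [(hch.hasSum_integral_zero ((hch.memLp_infoDensity hlam hlt hmu 0).integrable
      one_le_two)).unique (hasSum_mul_piQ hlam hlt hmu (serviceMean_infoDensity_succ hlam hlt hmu)),
    serviceMean_infoDensity_zero hlam hlt hmu, capacityC_eq hlam hlt hmu]

lemma IsTimingChannel.variance_infoDensity_zero (hlam : 0 < lam) (hlt : lam < mu) (hmu : mu < 1)
    (hch : IsTimingChannel P lam mu Q₀ A D) :
    Var[fun ω => infoDensity lam mu (composedState Q₀ A D 0 ω); P] = varExpr lam mu := by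
  have h2 : mu ≠ 0 := by linarith
  have hL := hch.memLp_infoDensity hlam hlt hmu 0
  rw [variance_eq_sub hL, hch.integral_infoDensity_zero hlam hlt hmu]
  have h := (hch.hasSum_integral_zero (χ := fun s => infoDensity lam mu s ^ 2)
    hL.integrable_sq).unique (hasSum_mul_piQ hlam hlt hmu (c := mu * Real.log (mu / lam) ^ 2 +
      (1 - mu) * Real.log ((1 - mu) / (1 - lam)) ^ 2) fun q => by
        simp only [serviceMean, serviceProb, infoDensity_false_succ hlam hlt hmu,
          infoDensity_true_succ hlam hlt hmu]
        ring)
  simp only [Pi.pow_apply]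
  rw [h, varExpr, piQ_zero]
  simp only [serviceMean, serviceProb, infoDensity_false_zero hlam hlt hmu]
  field_simp
  ring

lemma IsTimingChannel.integral_mul_queueLength_one (hlam : 0 < lam) (hlt : lam < mu) (hmu : mu < 1)
    (hch : IsTimingChannel P lam mu Q₀ A D) {φ : Bool × ℕ → ℝ} {B b c : ℝ}
    (hφ : ∀ s, |φ s| ≤ B)
    (hmean : ∀ q : ℕ, serviceMean mu (fun s => φ s * arrivalMean lam Nat.cast s) (q + 1) =
      b * (q + 1) + c) :
    ∫ ω, φ (composedState Q₀ A D 0 ω) * ((composedState Q₀ A D 1 ω).2 : ℝ) ∂P =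
      b * (lam * (1 - lam) / (mu - lam)) + φ (false, 0) * lam * ((mu - lam) / mu) +
        c * (lam / mu) := by
  have h0 : ∀ q : ℕ, |(q : ℝ)| ≤ (0 : ℕ) + 1 * q :=
    abs_queueStep_iterate_le hlam.le (hlt.trans hmu).le (hlam.trans hlt).le hmu.le 0
  have hi := hch.integrable_mul hlam hlt hmu 0 zero_le_one hφ
    (abs_arrivalMean_le hlam.le (hlt.trans hmu).le zero_le_one h0)
  rw [hch.integral_mul_succ hlam hlt hmu 0 (ψ := fun s => (s.2 : ℝ)) zero_le_one hφ
    fun s => h0 s.2, serviceMean_comp_snd]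
  have hs := hch.hasSum_integral_zero (χ := fun s => φ s * arrivalMean lam Nat.cast s) hi
  -- After removing the linear part `b * q`, the conditional mean is the constant `c` on busy
  -- states.
  have ht := ((hasSum_natCast_mul_piQ hlam hlt hmu).mul_left b).add (hasSum_mul_piQ hlam hlt hmu
    (φ := fun q => serviceMean mu (fun s => φ s * arrivalMean lam Nat.cast s) q - b * q) (c := c)
    fun q => by rw [hmean]; push_cast; ring)
  rw [hs.unique (ht.congr_fun fun q => by ring)]
  simp [serviceMean, serviceProb, arrivalMean]
  ring

lemma IsTimingChannel.lengthCov_infoDensity_one (hlam : 0 < lam) (hlt : lam < mu) (hmu : mu < 1)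
    (hch : IsTimingChannel P lam mu Q₀ A D) :
    lengthCov P Q₀ A D (infoDensity lam mu) 1 =
      (busyMean lam mu - capacityC lam mu) * (lam * (1 - lam) / (mu - lam)) -
        (Real.log (mu / lam) - capacityC lam mu) * lam := by
  have h2 : mu ≠ 0 := by linarith
  have h3 : mu - lam ≠ 0 := by linarith
  obtain ⟨M, hM0, hM⟩ := exists_abs_infoDensity_le hlam hlt hmu
  -- In `c`, an arrival contributes `λ` times the busy mean, and a departure, of probability `μ` and
  -- density `log (μ/λ)`, removes one customer.
  have e1 := hch.integral_mul_queueLength_one hlam hlt hmu hM (b := busyMean lam mu)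
    (c := busyMean lam mu * lam - mu * Real.log (mu / lam)) fun q => by
      simp [serviceMean, serviceProb, arrivalMean, infoDensity_false_succ hlam hlt hmu,
        infoDensity_true_succ hlam hlt hmu, busyMean]
      ring
  have e2 := hch.integral_mul_queueLength_one hlam hlt hmu (φ := fun _ => 1) (B := 1) (by simp)
    (b := 1) (c := lam - mu) fun q => by
      simp [serviceMean, serviceProb, arrivalMean]
      ring
  simp only [one_mul] at e2
  rw [lengthCov, e1, e2, hch.integral_infoDensity_zero hlam hlt hmu,
    infoDensity_false_zero hlam hlt hmu, capacityC_eq hlam hlt hmu]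
  field_simp
  ring

lemma IsTimingChannel.hasSum_covariance_infoDensity (hlam : 0 < lam) (hlt : lam < mu)
    (hmu : mu < 1) (hch : IsTimingChannel P lam mu Q₀ A D) :
    HasSum (fun i => cov[fun ω => infoDensity lam mu (composedState Q₀ A D 0 ω),
      fun ω => infoDensity lam mu (composedState Q₀ A D i ω); P]) (covSumExpr lam mu) := by
  obtain ⟨M, hM0, hM⟩ := exists_abs_infoDensity_le hlam hlt hmu
  obtain ⟨K, γ, hγ0, hγ1, hu⟩ := hch.exists_abs_lengthCov_le hlam hlt hmu hM
  set u : ℕ → ℝ := fun n => lengthCov P Q₀ A D (infoDensity lam mu) (n + 1) with hudef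
  have hus : Summable u := Summable.of_norm_bounded
    ((summable_geometric_of_lt_one hγ0 hγ1).mul_left K) hu
  -- Geometric decay removes the boundary term at infinity. The index starts at time 1 because the
  -- term `i = 0` is the variance, added back below.
  have htel : HasSum (fun n => u n - u (n + 1)) (u 0) := by
    rw [(hus.sub ((summable_nat_add_iff 1).2 hus)).hasSum_iff_tendsto_nat]
    simp only [Finset.sum_range_sub']
    simpa using hus.tendsto_atTop_zero.const_sub (u 0)
  have h0 : cov[fun ω => infoDensity lam mu (composedState Q₀ A D 0 ω),
      fun ω => infoDensity lam mu (composedState Q₀ A D 0 ω); P] = varExpr lam mu := by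
    rw [covariance_self (hch.memLp_infoDensity hlam hlt hmu 0).1.aemeasurable,
      hch.variance_infoDensity_zero hlam hlt hmu]
  have hsucc := ((htel.mul_left (poissonSlope lam mu)).congr_fun
    (hch.covariance_infoDensity_succ hlam hlt hmu)).zero_add (f := fun i =>
      cov[fun ω => infoDensity lam mu (composedState Q₀ A D 0 ω),
        fun ω => infoDensity lam mu (composedState Q₀ A D i ω); P])
  have hu0 : u 0 = lengthCov P Q₀ A D (infoDensity lam mu) 1 := rfl
  rwa [h0, hu0, hch.lengthCov_infoDensity_one hlam hlt hmu,
    ← covSumExpr_eq hlam hlt hmu] at hsucc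

/-- The covariances of the information densities are stationary. -/
lemma IsTimingChannel.covariance_infoDensity_add (hlam : 0 < lam) (hlt : lam < mu)
    (hmu : mu < 1) (hch : IsTimingChannel P lam mu Q₀ A D) (k m : ℕ) :
    cov[fun ω => infoDensity lam mu (composedState Q₀ A D m ω),
      fun ω => infoDensity lam mu (composedState Q₀ A D (k + m) ω); P] =
    cov[fun ω => infoDensity lam mu (composedState Q₀ A D 0 ω),
      fun ω => infoDensity lam mu (composedState Q₀ A D k ω); P] := by
  obtain ⟨Q₀', A', D', hch', hs⟩ := hch.exists_shift hlam hlt hmu m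
  have h0 : ∀ ω, composedState Q₀ A D m ω = composedState Q₀' A' D' 0 ω := fun ω => by
    rw [hs, zero_add]
  simp only [h0, ← hs]
  rw [covariance_eq_sub (hch'.memLp_infoDensity hlam hlt hmu 0)
      (hch'.memLp_infoDensity hlam hlt hmu k),
    covariance_eq_sub (hch.memLp_infoDensity hlam hlt hmu 0)
      (hch.memLp_infoDensity hlam hlt hmu k)]
  simp only [Pi.mul_apply]
  rw [hch'.integral_pair_eq hch (fun s t => infoDensity lam mu s * infoDensity lam mu t) k,
    hch'.integral_pair_eq hch (fun s _ => infoDensity lam mu s) k,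
    hch'.integral_pair_eq hch (fun _ t => infoDensity lam mu t) k]

end Channel

/-- For a stationary sequence with summable covariances, the normalized variance of the partial
sums converges to the two-sided sum of the covariances. -/
lemma tendsto_variance_sum_div {Ω : Type*} [MeasurableSpace Ω] {P : Measure Ω}
    [IsProbabilityMeasure P] {F : ℕ → Ω → ℝ} (hF : ∀ i, MemLp (F i) 2 P)
    (hst : ∀ k m, cov[F m, F (k + m); P] = cov[F 0, F k; P]) {S : ℝ}
    (hS : HasSum (fun i => cov[F 0, F i; P]) S) :
    Tendsto (fun n : ℕ => (1 / (n : ℝ)) * Var[fun ω => ∑ i ∈ Finset.range n, F i ω; P]) atTop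
      (𝓝 (-Var[F 0; P] + 2 * S)) := by
  set c : ℕ → ℝ := fun i => cov[F 0, F i; P] with hc
  have hc0 : c 0 = Var[F 0; P] := covariance_self (hF 0).1.aemeasurable
  have hcov : ∀ n, cov[fun ω => ∑ i ∈ Finset.range n, F i ω, F n; P] =
      ∑ k ∈ Finset.range n, c (k + 1) := by
    intro n
    -- Reflection indexes the terms by the distance to `n`, which stationarity requires.
    rw [covariance_fun_sum_left' (fun i _ => hF i) (hF n), ← Finset.sum_range_reflect]
    refine Finset.sum_congr rfl fun k hk => ?_
    rw [Finset.mem_range] at hk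
    have := hst (k + 1) (n - 1 - k)
    rwa [show k + 1 + (n - 1 - k) = n by omega] at this
  -- The increment from `j` to `j + 1` is `c 0` plus twice the sum of `c 1, …, c j`; including `c 0`
  -- in the doubled sum costs the `-c 0`.
  have hvar : ∀ n, Var[fun ω => ∑ i ∈ Finset.range n, F i ω; P] =
      ∑ j ∈ Finset.range n, (-c 0 + 2 * ∑ k ∈ Finset.range (j + 1), c k) := by
    intro n
    induction n with
    | zero =>
      simp only [Finset.range_zero, Finset.sum_empty]
      exact variance_zero P
    | succ n ih =>
      have hL : MemLp (fun ω => ∑ i ∈ Finset.range n, F i ω) 2 P :=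
        memLp_finsetSum _ fun i _ => hF i
      have hn : Var[F n; P] = c 0 := by
        rw [← covariance_self (hF n).1.aemeasurable]
        simpa using hst 0 n
      simp only [Finset.sum_range_succ (fun i => F i _) n]
      rw [variance_fun_add hL (hF n), ih, hcov, hn, Finset.sum_range_succ _ n,
        Finset.sum_range_succ' c]
      ring
  have hlim : Tendsto (fun j => -c 0 + 2 * ∑ k ∈ Finset.range (j + 1), c k) atTop
      (𝓝 (-c 0 + 2 * S)) :=
    ((hS.tendsto_sum_nat.comp (tendsto_add_atTop_nat 1)).const_mul 2).const_add _
  rw [← hc0]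
  simpa only [hvar, one_div] using hlim.cesaro

end

/-- Absolute convergence is contained in `HasSum`, since unconditional summability of reals is
absolute. -/
theorem theorem6 {Ω : Type*} [MeasurableSpace Ω] (P : Measure Ω) [IsProbabilityMeasure P]
    (lam mu : ℝ) (hlam : 0 < lam) (hlt : lam < mu) (hmu : mu < 1)
    (Q₀ : Ω → ℕ) (A D : ℕ → Ω → Bool) (hch : IsTimingChannel P lam mu Q₀ A D)
    (F : ℕ → Ω → ℝ) (hF : ∀ i ω, F i ω = infoDensity lam mu (composedState Q₀ A D i ω)) :
    ∃ σsq : ℝ,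
      Tendsto (fun n : ℕ => (1 / (n : ℝ)) * Var[fun ω => ∑ i ∈ Finset.range n, F i ω; P])
        atTop (𝓝 σsq) ∧
      σsq = -Var[F 0; P] + 2 * ∑' i : ℕ, cov[F 0, F i; P] ∧
      Var[F 0; P] = varExpr lam mu ∧
      HasSum (fun i : ℕ => cov[F 0, F i; P]) (covSumExpr lam mu) ∧
      σsq = -varExpr lam mu + 2 * covSumExpr lam mu := by
  obtain rfl : F = fun i ω => infoDensity lam mu (composedState Q₀ A D i ω) :=
    funext fun i => funext (hF i)
  have hV := hch.variance_infoDensity_zero hlam hlt hmu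
  have hS := hch.hasSum_covariance_infoDensity hlam hlt hmu
  have hT := tendsto_variance_sum_div (hch.memLp_infoDensity hlam hlt hmu)
    (hch.covariance_infoDensity_add hlam hlt hmu) hS
  exact ⟨_, hT, by rw [hS.tsum_eq], hV, hS, by rw [hV]⟩
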